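/- A plane partition is an array $\pi=(\pi_{i,j})_{i,j\ge 0}$ of non-negative integers (column heights), with only finitely many non-zero entries, that is weakly decreasing along every row and every column; its volume is $|\pi|=\sum_{i,j}\pi_{i,j}$. For $h>0$, an $h$-path of $\pi$ is a maximal edge-connected set of positions $(i,j)$ with $\pi_{i,j}=h$ (two positions being adjacent if they differ by $1$ in exactly one coordinate and agree in the other), and $p(\pi)$ denotes the total number of $h$-paths of $\pi$ over all $h>0$. Call $\pi$ diagonally strict if on every diagonal $j-i=\text{const}$ the non-zero entries are pairwise distinct. (a) A plane partition $\pi$ is diagonally strict if and only if each of its $h$-paths is one column wide, i.e. any two positions of the $h$-path are joined by exactly one self-avoiding sequence of adjacent positions in the $h$-path. (b) As formal power series in the indeterminate $q$, $$\sum_{\pi}2^{p(\pi)}q^{|\pi|}=\prod_{n=1}^{\infty}\left(\frac{1+q^n}{1-q^n}\right)^{n},$$ where the sum runs over all diagonally strict plane partitions $\pi$, and both the sum and the product converge in the topology of coefficientwise convergence. -/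

import Mathlib

open scoped PowerSeries PowerSeries.WithPiTopology

/-- A plane partition: a finitely supported array of column heights, indexed by
`(row, column) ∈ ℕ × ℕ`, that is weakly decreasing along rows and along columns
(`ℕ × ℕ` carries the product order). The highest column is at the corner `(0, 0)`. -/
structure PlanePartition where
  /-- the column heights -/
  height : ℕ × ℕ →₀ ℕ
  antitone_height : Antitone height

namespace PlanePartition

/-- The volume: the sum of all column heights. -/
def volume (π : PlanePartition) : ℕ :=
  π.height.sum fun _ h => h

/-- The positions of the columns of positive height. -/
abbrev Cell (π : PlanePartition) : Type :=
  {c : ℕ × ℕ // 0 < π.height c}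

/-- Two positions of the array are neighbours when they share an edge. -/
def Neighbour (c d : ℕ × ℕ) : Prop :=
  (c.1 = d.1 ∧ (c.2 + 1 = d.2 ∨ d.2 + 1 = c.2)) ∨
    (c.2 = d.2 ∧ (c.1 + 1 = d.1 ∨ d.1 + 1 = c.1))

/-- The graph on the columns of positive height in which two columns are joined when they are
neighbours and have the same height. -/
def pathGraph (π : PlanePartition) : SimpleGraph π.Cell where
  Adj c d := Neighbour c.1 d.1 ∧ π.height c.1 = π.height d.1
  symm := ⟨fun c d h => by
    refine ⟨?_, h.2.symm⟩
    have := h.1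
    unfold Neighbour at *
    omega⟩
  loopless := ⟨fun c h => by
    have := h.1
    unfold Neighbour at this
    omega⟩

/-- An `h`-path, for some `h > 0`: a maximal connected set of adjacent columns of equal
height `h`. -/
abbrev HPath (π : PlanePartition) : Type :=
  π.pathGraph.ConnectedComponent

/-- The number of `h`-paths, over all `h > 0`. -/
noncomputable def numPaths (π : PlanePartition) : ℕ :=
  Nat.card π.HPath

/-- Every `h`-path is one column wide: there is at most one way to move, without visiting a
column twice, along an `h`-path from one of its columns to another. -/
def OneColumnWide (π : PlanePartition) : Prop :=
  ∀ (c d : π.Cell) (v w : π.pathGraph.Path c d), v = w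

/-- Along every diagonal (positions with the same value of `column - row`) the positive heights
are pairwise distinct, that is, every diagonal slice is a strict partition. -/
def DiagonallyStrict (π : PlanePartition) : Prop :=
  ∀ c d : ℕ × ℕ, (c.2 : ℤ) - c.1 = (d.2 : ℤ) - d.1 →
    0 < π.height c → π.height c = π.height d → c = d

end PlanePartition

/-! (a) Heights decrease weakly along rows and columns, so a height repeated on a diagonal forces a
constant 2 × 2 block, around which there are two paths. Conversely, in a cycle of columns of equal
height, one of maximal content (column minus row) has two distinct neighbours on the preceding
diagonal, against diagonal strictness.

(b) The diagonal slices of a diagonally strict plane partition are strict partitions that interlace,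
shrinking away from the main diagonal, and every such two-sided sequence occurs
(`exists_diagSet_eq`). A path runs through consecutive diagonals, meeting each once, so p(π) counts
the parts of slices that are absent from the preceding slice (`numPaths_eq`). By Abel summation,
2^p(π) q^|π| is then a product of one-step weights: steps up to the main diagonal with parameters
x_i = q^(i+1), and steps down from it with y_j = q^j.

Moving a down step past an up step costs the factor (1 + xy)/(1 - xy)
(`formalSum_upWeight_mul_downWeight`). Doing this for all pairs leaves trivial chains and the
product of (1 + q^(i+j+1))/(1 - q^(i+j+1)) over all i, j, where the exponent n occurs n times. The
commutation is proved in the refined form `upDown_downUp`, by induction on deleting the first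
columns of the Young diagrams.

Sums are rearranged over ℝ≥0∞, where convergence is automatic. The coefficient of q^n involves only
finitely many diagonals and is a natural number, so the identity transfers to ℚ through
`factorSeries`, which has coefficients in ℕ. -/

open scoped ENNReal
open PowerSeries

/-! ### Formal sums of power series with coefficients in `ℝ≥0∞`

Over `ℝ≥0∞` every family of power series has a coefficientwise sum, so that sums may be
interchanged freely. -/

/-- The coefficientwise sum of an arbitrary family of power series over `ℝ≥0∞`. -/
noncomputable def formalSum {ι : Type*} (f : ι → ℝ≥0∞⟦X⟧) : ℝ≥0∞⟦X⟧ :=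
  PowerSeries.mk fun n => ∑' i, coeff n (f i)

section FormalSum

variable {ι κ : Type*}

lemma coeff_formalSum (f : ι → ℝ≥0∞⟦X⟧) (n : ℕ) :
    coeff n (formalSum f) = ∑' i, coeff n (f i) := by
  simp [formalSum]

lemma formalSum_add (f g : ι → ℝ≥0∞⟦X⟧) :
    formalSum (fun i => f i + g i) = formalSum f + formalSum g := by
  ext n
  simp [coeff_formalSum, ENNReal.tsum_add]

lemma formalSum_mul_left (a : ℝ≥0∞⟦X⟧) (f : ι → ℝ≥0∞⟦X⟧) :
    formalSum (fun i => a * f i) = a * formalSum f := by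
  ext n
  simp only [coeff_formalSum, coeff_mul]
  rw [Summable.tsum_finsetSum fun _ _ => ENNReal.summable]
  simp [ENNReal.tsum_mul_left]

lemma formalSum_mul_right (a : ℝ≥0∞⟦X⟧) (f : ι → ℝ≥0∞⟦X⟧) :
    formalSum (fun i => f i * a) = formalSum f * a := by
  simp only [mul_comm _ a, formalSum_mul_left]

lemma formalSum_comm (f : ι → κ → ℝ≥0∞⟦X⟧) :
    formalSum (fun i => formalSum (f i)) = formalSum fun k => formalSum fun i => f i k := by
  ext n
  simp only [coeff_formalSum]
  exact ENNReal.tsum_comm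

lemma formalSum_prod (f : ι × κ → ℝ≥0∞⟦X⟧) :
    formalSum f = formalSum fun i => formalSum fun k => f (i, k) := by
  ext n
  simp only [coeff_formalSum]
  exact ENNReal.tsum_prod (f := fun i k => coeff n (f (i, k)))

lemma formalSum_injective {g : ι → κ} (hg : Function.Injective g) {f : κ → ℝ≥0∞⟦X⟧}
    (hf : ∀ k, f k ≠ 0 → k ∈ Set.range g) : formalSum (fun i => f (g i)) = formalSum f := by
  ext n
  simp only [coeff_formalSum]
  refine hg.tsum_eq (f := fun k => coeff n (f k)) fun k hk => hf k fun h => hk ?_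
  simp [h]

lemma formalSum_equiv (e : ι ≃ κ) (f : κ → ℝ≥0∞⟦X⟧) :
    formalSum (fun i => f (e i)) = formalSum f :=
  formalSum_injective e.injective fun k _ => ⟨e.symm k, by simp⟩

lemma formalSum_eq_single {f : ι → ℝ≥0∞⟦X⟧} (a : ι) (h : ∀ i, i ≠ a → f i = 0) :
    formalSum f = f a := by
  ext n
  rw [coeff_formalSum, tsum_eq_single a]
  intro i hi
  simp [h i hi]

lemma formalSum_bool (f : Bool → ℝ≥0∞⟦X⟧) : formalSum f = f false + f true := by
  ext n
  rw [coeff_formalSum, tsum_fintype]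
  simp [add_comm]

lemma formalSum_zero : formalSum (fun _ : ι => 0) = 0 := by
  ext n
  simp [coeff_formalSum]

/-- The geometric series. -/
noncomputable def geom (z : ℝ≥0∞⟦X⟧) : ℝ≥0∞⟦X⟧ := formalSum fun k : ℕ => z ^ k

lemma geom_eq (z : ℝ≥0∞⟦X⟧) : geom z = 1 + z * geom z := by
  rw [geom, ← formalSum_mul_left]
  ext n
  rw [map_add, coeff_formalSum, coeff_formalSum, tsum_eq_zero_add' ENNReal.summable]
  simp [pow_succ']

/-- The series `(1 + z) / (1 - z) = 1 + 2 z + 2 z ^ 2 + ⋯`. -/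
noncomputable def cauchyFactor (z : ℝ≥0∞⟦X⟧) : ℝ≥0∞⟦X⟧ := 1 + 2 * z * geom z

end FormalSum

/-! ### Strict partitions as finite sets

A strict partition is encoded as the finite set of its parts, each decreased by one. -/

namespace StrictPartition

/-- The number of parts exceeding `h`. -/
def tailCard (s : Finset ℕ) (h : ℕ) : ℕ := (s.filter (h ≤ ·)).card

/-- The sum of the parts. -/
def size (s : Finset ℕ) : ℕ := ∑ i ∈ s, (i + 1)

/-- The parts of `s` and `t` interlace, `t` being the larger partition. -/
def Interlace (s t : Finset ℕ) : Prop :=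
  ∀ h, tailCard s h ≤ tailCard t h ∧ tailCard t h ≤ tailCard s h + 1

/-- The strict partition whose parts are those of `s` increased by one, together with the
part `1` if `b` holds. -/
def consBit (b : Bool) (s : Finset ℕ) : Finset ℕ :=
  if b then insert 0 (s.map (addRightEmbedding 1)) else s.map (addRightEmbedding 1)

@[simp] lemma zero_mem_consBit {b : Bool} {s : Finset ℕ} : 0 ∈ consBit b s ↔ b = true := by
  cases b <;> simp [consBit]

@[simp] lemma succ_mem_consBit {b : Bool} {s : Finset ℕ} {n : ℕ} :
    n + 1 ∈ consBit b s ↔ n ∈ s := by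
  cases b <;> simp [consBit]

/-- Splitting off the part `1`. -/
def consEquiv : Bool × Finset ℕ ≃ Finset ℕ where
  toFun p := consBit p.1 p.2
  invFun s := (decide (0 ∈ s), (s.erase 0).image Nat.pred)
  left_inv p := by
    obtain ⟨b, s⟩ := p
    ext n
    · simp
    · simp only [Finset.mem_image, Finset.mem_erase]
      constructor
      · rintro ⟨m, ⟨hm, hm'⟩, rfl⟩
        obtain ⟨m, rfl⟩ := Nat.exists_eq_succ_of_ne_zero hm
        simpa using hm'
      · intro hn
        exact ⟨n + 1, by simpa using hn, rfl⟩
  right_inv s := by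
    ext n
    cases n with
    | zero => simp
    | succ n =>
      simp only [succ_mem_consBit, Finset.mem_image, Finset.mem_erase]
      constructor
      · rintro ⟨m, ⟨hm, hm'⟩, rfl⟩
        obtain ⟨m, rfl⟩ := Nat.exists_eq_succ_of_ne_zero hm
        simpa using hm'
      · intro hn
        exact ⟨n + 1, by simpa using hn, rfl⟩

lemma tailCard_zero (s : Finset ℕ) : tailCard s 0 = s.card := by simp [tailCard]

lemma tailCard_empty (h : ℕ) : tailCard ∅ h = 0 := by simp [tailCard]

lemma sum_consBit {M : Type*} [AddCommMonoid M] (b : Bool) (s : Finset ℕ) (f : ℕ → M) :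
    ∑ i ∈ consBit b s, f i = (if b then f 0 else 0) + ∑ i ∈ s, f (i + 1) := by
  cases b <;> simp [consBit]

lemma card_consBit (b : Bool) (s : Finset ℕ) : (consBit b s).card = b.toNat + s.card := by
  have := sum_consBit b s fun _ => 1
  cases b <;> simpa using this

lemma tailCard_consBit_succ (b : Bool) (s : Finset ℕ) (h : ℕ) :
    tailCard (consBit b s) (h + 1) = tailCard s h := by
  rw [tailCard, Finset.card_filter, sum_consBit, tailCard, Finset.card_filter]
  simp

/-- Passing from `consBit b s` to `s` deletes the first column of the Young diagram, whose length is
the number of parts. -/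
lemma size_consBit (b : Bool) (s : Finset ℕ) :
    size (consBit b s) = (consBit b s).card + size s := by
  have h : ∑ i ∈ s, (i + 1 + 1) = ∑ i ∈ s, (i + 1) + s.card := by
    rw [Finset.sum_add_distrib, Finset.sum_const, smul_eq_mul, mul_one]
  rw [card_consBit, size, size, sum_consBit, h]
  cases b
  · simp [add_comm]
  · simp only [if_true, Bool.toNat_true]
    omega

lemma card_sdiff_consBit (b c : Bool) (s t : Finset ℕ) :
    (consBit b s \ consBit c t).card = (b && !c).toNat + (s \ t).card := by
  rw [← card_consBit]
  congr 1
  ext n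
  cases n <;> simp

lemma Interlace.card_le {s t : Finset ℕ} (h : Interlace s t) :
    s.card ≤ t.card ∧ t.card ≤ s.card + 1 := by
  simpa [tailCard_zero] using h 0

lemma interlace_consBit {b c : Bool} {s t : Finset ℕ} :
    Interlace (consBit b s) (consBit c t) ↔
      ((consBit b s).card ≤ (consBit c t).card ∧ (consBit c t).card ≤ (consBit b s).card + 1) ∧
        Interlace s t := by
  constructor
  · intro h
    exact ⟨h.card_le, fun n => by simpa [tailCard_consBit_succ] using h (n + 1)⟩
  · rintro ⟨h₀, h⟩ n
    cases n with
    | zero => simpa [tailCard_zero] using h₀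
    | succ n => simpa [tailCard_consBit_succ] using h n

/-- Simultaneous induction on two strict partitions by splitting off the parts `1`. -/
lemma induction₂ {P : Finset ℕ → Finset ℕ → Prop} (empty : P ∅ ∅)
    (cons : ∀ b c s t, P s t → P (consBit b s) (consBit c t)) (s t : Finset ℕ) : P s t := by
  have key : ∀ n, ∀ s t : Finset ℕ, (∀ i ∈ s, i < n) → (∀ i ∈ t, i < n) → P s t := by
    intro n
    induction n with
    | zero =>
      intro s t hs ht
      obtain rfl : s = ∅ := Finset.eq_empty_of_forall_notMem fun i hi => by simpa using hs i hi
      obtain rfl : t = ∅ := Finset.eq_empty_of_forall_notMem fun i hi => by simpa using ht i hi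
      exact empty
    | succ n ih =>
      intro s t hs ht
      obtain ⟨⟨b, s⟩, rfl⟩ := consEquiv.surjective s
      obtain ⟨⟨c, t⟩, rfl⟩ := consEquiv.surjective t
      refine cons b c s t (ih s t (fun i hi => ?_) fun i hi => ?_)
      · have := hs (i + 1) (by simpa [consEquiv] using hi)
        omega
      · have := ht (i + 1) (by simpa [consEquiv] using hi)
        omega
  refine key (s.sup id + t.sup id + 1) s t (fun i hi => ?_) fun i hi => ?_
  · have := Finset.le_sup (f := id) hi
    simp only [id] at this
    omega
  · have := Finset.le_sup (f := id) hi
    simp only [id] at this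
    omega

lemma size_le_of_interlace {s t : Finset ℕ} : Interlace s t → size s ≤ size t := by
  induction s, t using induction₂ with
  | empty => simp
  | cons b c s t ih =>
    intro h
    rw [interlace_consBit] at h
    rw [size_consBit, size_consBit]
    have := ih h.2
    omega

end StrictPartition

/-! ### Weighted steps between strict partitions and their commutation -/

namespace StrictPartition

open Classical in
/-- The weight of a step from `s` up to `t`, restricted to the steps that add `a` parts. -/
noncomputable def upWeightOf (x : ℝ≥0∞⟦X⟧) (a : ℤ) (s t : Finset ℕ) : ℝ≥0∞⟦X⟧ :=
  if Interlace s t ∧ (t.card : ℤ) = s.card + a then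
    2 ^ (t \ s).card * x ^ (size t - size s) else 0

open Classical in
/-- The weight of a step from `t` down to `s`, restricted to the steps that remove `a` parts. -/
noncomputable def downWeightOf (x : ℝ≥0∞⟦X⟧) (a : ℤ) (t s : Finset ℕ) : ℝ≥0∞⟦X⟧ :=
  if Interlace s t ∧ (t.card : ℤ) = s.card + a then
    2 ^ (s \ t).card * x ^ (size t - size s) else 0

open Classical in
/-- The weight of a step from `s` up to `t`. -/
noncomputable def upWeight (x : ℝ≥0∞⟦X⟧) (s t : Finset ℕ) : ℝ≥0∞⟦X⟧ :=
  if Interlace s t then 2 ^ (t \ s).card * x ^ (size t - size s) else 0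

open Classical in
/-- The weight of a step from `t` down to `s`. -/
noncomputable def downWeight (x : ℝ≥0∞⟦X⟧) (t s : Finset ℕ) : ℝ≥0∞⟦X⟧ :=
  if Interlace s t then 2 ^ (s \ t).card * x ^ (size t - size s) else 0

lemma upWeight_eq (x : ℝ≥0∞⟦X⟧) (s t : Finset ℕ) :
    upWeight x s t = upWeightOf x 0 s t + upWeightOf x 1 s t := by
  unfold upWeight upWeightOf
  by_cases h : Interlace s t
  · have := h.card_le
    rcases (show t.card = s.card ∨ t.card = s.card + 1 by omega) with h' | h' <;> simp [h, h']
  · simp [h]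

lemma downWeight_eq (x : ℝ≥0∞⟦X⟧) (t s : Finset ℕ) :
    downWeight x t s = downWeightOf x 0 t s + downWeightOf x 1 t s := by
  unfold downWeight downWeightOf
  by_cases h : Interlace s t
  · have := h.card_le
    rcases (show t.card = s.card ∨ t.card = s.card + 1 by omega) with h' | h' <;> simp [h, h']
  · simp [h]

/-- Interlacing partitions differ by at most one part. The index is an integer because deleting
first columns shifts it, possibly out of {0, 1}. -/
lemma upWeightOf_eq_zero (x : ℝ≥0∞⟦X⟧) {a : ℤ} (ha : a < 0 ∨ 1 < a) (s t : Finset ℕ) :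
    upWeightOf x a s t = 0 := by
  rw [upWeightOf, if_neg]
  rintro ⟨h, h'⟩
  have := h.card_le
  omega

lemma downWeightOf_eq_zero (x : ℝ≥0∞⟦X⟧) {a : ℤ} (ha : a < 0 ∨ 1 < a) (t s : Finset ℕ) :
    downWeightOf x a t s = 0 := by
  rw [downWeightOf, if_neg]
  rintro ⟨h, h'⟩
  have := h.card_le
  omega

lemma interlace_consBit_and_card {a : ℕ} (ha : a ≤ 1) (b c : Bool) (s t : Finset ℕ) :
    (Interlace (consBit b s) (consBit c t) ∧
        ((consBit c t).card : ℤ) = (consBit b s).card + (a : ℤ)) ↔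
      (Interlace s t ∧ (t.card : ℤ) = s.card + ((a : ℤ) + b.toNat - c.toNat)) := by
  rw [interlace_consBit, card_consBit, card_consBit]
  push_cast
  constructor
  · rintro ⟨⟨_, h⟩, h'⟩
    exact ⟨h, by omega⟩
  · rintro ⟨h, h'⟩
    exact ⟨⟨by omega, h⟩, by omega⟩

lemma size_consBit_sub {a : ℕ} {b c : Bool} {s t : Finset ℕ} (h : Interlace s t)
    (h' : (t.card : ℤ) = s.card + ((a : ℤ) + b.toNat - c.toNat)) :
    size (consBit c t) - size (consBit b s) = a + (size t - size s) := by
  have := size_le_of_interlace h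
  rw [size_consBit, size_consBit, card_consBit, card_consBit]
  omega

/-- The deleted first columns differ in length by `a`, whence `x ^ a`. The part 1 is new exactly
when `c && !b`, whence the power of 2. -/
lemma upWeightOf_consBit (x : ℝ≥0∞⟦X⟧) {a : ℕ} (ha : a ≤ 1) (b c : Bool) (s t : Finset ℕ) :
    upWeightOf x a (consBit b s) (consBit c t) =
      x ^ a * 2 ^ (c && !b).toNat * upWeightOf x (a + b.toNat - c.toNat) s t := by
  unfold upWeightOf
  have hiff := interlace_consBit_and_card ha b c s t
  by_cases h : Interlace s t ∧ (t.card : ℤ) = s.card + ((a : ℤ) + b.toNat - c.toNat)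
  · rw [if_pos (hiff.2 h), if_pos h, size_consBit_sub h.1 h.2, card_sdiff_consBit]
    ring
  · rw [if_neg (mt hiff.1 h), if_neg h, mul_zero]

lemma downWeightOf_consBit (x : ℝ≥0∞⟦X⟧) {a : ℕ} (ha : a ≤ 1) (b c : Bool) (s t : Finset ℕ) :
    downWeightOf x a (consBit c t) (consBit b s) =
      x ^ a * 2 ^ (b && !c).toNat * downWeightOf x (a + b.toNat - c.toNat) t s := by
  unfold downWeightOf
  have hiff := interlace_consBit_and_card ha b c s t
  by_cases h : Interlace s t ∧ (t.card : ℤ) = s.card + ((a : ℤ) + b.toNat - c.toNat)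
  · rw [if_pos (hiff.2 h), if_pos h, size_consBit_sub h.1 h.2, card_sdiff_consBit]
    ring
  · rw [if_neg (mt hiff.1 h), if_neg h, mul_zero]

lemma interlace_empty_right {s : Finset ℕ} : Interlace s ∅ ↔ s = ∅ := by
  constructor
  · intro h
    simpa using h.card_le.1
  · rintro rfl h
    simp

lemma interlace_empty_left {t : Finset ℕ} : Interlace ∅ t ↔ t.card ≤ 1 := by
  constructor
  · intro h
    simpa using h.card_le.2
  · intro h n
    simp only [tailCard_empty]
    exact ⟨by omega, (Finset.card_filter_le t _).trans h⟩

/-- The sum over all two-step sequences `s → ν → t` going up, then down, in which the numbers of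
added and removed parts are `a` and `b`. -/
noncomputable def upDown (x y : ℝ≥0∞⟦X⟧) (a b : ℤ) (s t : Finset ℕ) : ℝ≥0∞⟦X⟧ :=
  formalSum fun ν => upWeightOf x a s ν * downWeightOf y b ν t

/-- The sum over all two-step sequences `s → κ → t` going down, then up, in which the numbers of
removed and added parts are `a` and `b`. -/
noncomputable def downUp (x y : ℝ≥0∞⟦X⟧) (a b : ℤ) (s t : Finset ℕ) : ℝ≥0∞⟦X⟧ :=
  formalSum fun κ => downWeightOf y a s κ * upWeightOf x b κ t

lemma formalSum_consBit (f : Finset ℕ → ℝ≥0∞⟦X⟧) :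
    formalSum f = formalSum (fun s => f (consBit false s)) +
      formalSum fun s => f (consBit true s) := by
  rw [← formalSum_equiv consEquiv, formalSum_prod, formalSum_bool]
  rfl

/-- The two summands correspond to an intermediate partition without and with the part 1. -/
lemma upDown_consBit (x y : ℝ≥0∞⟦X⟧) {a b : ℕ} (ha : a ≤ 1) (hb : b ≤ 1) (l m : Bool)
    (s t : Finset ℕ) :
    upDown x y a b (consBit l s) (consBit m t) =
      x ^ a * y ^ b * (2 ^ m.toNat * upDown x y (a + l.toNat) (b + m.toNat) s t +
        2 ^ (!l).toNat * upDown x y (a + l.toNat - 1) (b + m.toNat - 1) s t) := by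
  rw [upDown, formalSum_consBit]
  simp only [upWeightOf_consBit x ha, downWeightOf_consBit y hb, upDown]
  rw [mul_add, ← formalSum_mul_left, ← formalSum_mul_left, ← formalSum_mul_left,
    ← formalSum_mul_left]
  congr 2 <;> funext ν <;> cases l <;> cases m <;> simp <;> ring

lemma downUp_consBit (x y : ℝ≥0∞⟦X⟧) {a b : ℕ} (ha : a ≤ 1) (hb : b ≤ 1) (l m : Bool)
    (s t : Finset ℕ) :
    downUp x y a b (consBit l s) (consBit m t) =
      y ^ a * x ^ b * (2 ^ m.toNat * downUp x y (a - l.toNat) (b - m.toNat) s t +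
        2 ^ (!l).toNat * downUp x y (a + 1 - l.toNat) (b + 1 - m.toNat) s t) := by
  rw [downUp, formalSum_consBit]
  simp only [upWeightOf_consBit x hb, downWeightOf_consBit y ha, downUp]
  rw [mul_add, ← formalSum_mul_left, ← formalSum_mul_left, ← formalSum_mul_left,
    ← formalSum_mul_left]
  congr 2 <;> funext ν <;> cases l <;> cases m <;> simp <;> ring

lemma upDown_eq_zero (x y : ℝ≥0∞⟦X⟧) {a b : ℤ} (h : a < 0 ∨ 1 < a ∨ b < 0 ∨ 1 < b)
    (s t : Finset ℕ) : upDown x y a b s t = 0 := by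
  rw [upDown]
  convert formalSum_zero with ν
  rcases h with h | h | h | h
  · rw [upWeightOf_eq_zero x (.inl h), zero_mul]
  · rw [upWeightOf_eq_zero x (.inr h), zero_mul]
  · rw [downWeightOf_eq_zero y (.inl h), mul_zero]
  · rw [downWeightOf_eq_zero y (.inr h), mul_zero]

lemma downUp_eq_zero (x y : ℝ≥0∞⟦X⟧) {a b : ℤ} (h : a < 0 ∨ 1 < a ∨ b < 0 ∨ 1 < b)
    (s t : Finset ℕ) : downUp x y a b s t = 0 := by
  rw [downUp]
  convert formalSum_zero with ν
  rcases h with h | h | h | h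
  · rw [downWeightOf_eq_zero y (.inl h), zero_mul]
  · rw [downWeightOf_eq_zero y (.inr h), zero_mul]
  · rw [upWeightOf_eq_zero x (.inl h), mul_zero]
  · rw [upWeightOf_eq_zero x (.inr h), mul_zero]

lemma size_empty : size ∅ = 0 := by simp [size]

lemma upDown_empty_of_eq_zero (x y : ℝ≥0∞⟦X⟧) (b : ℤ) :
    upDown x y 0 b ∅ ∅ = if b = 0 then 1 else 0 := by
  rw [upDown, formalSum_eq_single ∅]
  · simp [upWeightOf, downWeightOf, interlace_empty_left, eq_comm]
  · intro ν hν
    rw [upWeightOf, if_neg, zero_mul]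
    rintro ⟨-, h⟩
    simp at h
    exact hν h

lemma upDown_empty_one_zero (x y : ℝ≥0∞⟦X⟧) : upDown x y 1 0 ∅ ∅ = 0 := by
  rw [upDown]
  convert formalSum_zero with ν
  by_cases h : ν.card = 0
  · rw [upWeightOf, if_neg (by simp [h]), zero_mul]
  · rw [downWeightOf, if_neg (fun h' => h (by simpa using h'.2)), mul_zero]

lemma upDown_empty_one_one (x y : ℝ≥0∞⟦X⟧) :
    upDown x y 1 1 ∅ ∅ = 2 * (x * y) * geom (x * y) := by
  rw [upDown, ← formalSum_injective (g := fun n : ℕ => ({n} : Finset ℕ))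
    Finset.singleton_injective, geom, ← formalSum_mul_left]
  · congr 1
    funext n
    simp [upWeightOf, downWeightOf, interlace_empty_left, size]
    ring
  · intro ν hν
    have h : ν.card = 1 := by
      by_contra h
      apply hν
      rw [upWeightOf, if_neg, zero_mul]
      simp only [Finset.card_empty, not_and]
      intro _ h'
      apply h
      omega
    obtain ⟨n, rfl⟩ := Finset.card_eq_one.1 h
    exact ⟨n, rfl⟩

lemma downUp_empty (x y : ℝ≥0∞⟦X⟧) (a b : ℤ) :
    downUp x y a b ∅ ∅ = if a = 0 ∧ b = 0 then 1 else 0 := by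
  rw [downUp, formalSum_eq_single ∅]
  · by_cases ha : a = 0 <;> by_cases hb : b = 0 <;>
      simp [upWeightOf, downWeightOf, interlace_empty_left, eq_comm, ha, hb]
  · intro ν hν
    rw [downWeightOf, if_neg, zero_mul]
    rintro ⟨h, -⟩
    exact hν (interlace_empty_right.1 h)

lemma geom_mul (z k : ℝ≥0∞⟦X⟧) : geom z * k = k + z * geom z * k := by
  nth_rw 1 [geom_eq z]
  ring

lemma add_eq_cauchyFactor_mul {z f₀ f₁ g₀ g₁ : ℝ≥0∞⟦X⟧} (h₀ : f₀ = g₀ + 2 * geom z * g₁)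
    (h₁ : f₁ + g₁ = 2 * z * geom z * g₀) : f₀ + f₁ = cauchyFactor z * (g₀ + g₁) := by
  calc
    f₀ + f₁ = g₀ + 2 * (geom z * g₁) + f₁ := by rw [h₀]; ring
    _ = g₀ + g₁ + 2 * z * geom z * g₁ + (f₁ + g₁) := by rw [geom_mul]; ring
    _ = _ := by rw [h₁, cauchyFactor]; ring

/-- Refined commutation relations between upward and downward steps. -/
lemma upDown_downUp (x y : ℝ≥0∞⟦X⟧) (s t : Finset ℕ) :
    (upDown x y 0 0 s t = downUp x y 0 0 s t + 2 * geom (x * y) * downUp x y 1 1 s t ∧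
      upDown x y 1 1 s t + downUp x y 1 1 s t =
        2 * (x * y) * geom (x * y) * downUp x y 0 0 s t) ∧
    upDown x y 0 1 s t = cauchyFactor (x * y) * downUp x y 1 0 s t ∧
    upDown x y 1 0 s t = cauchyFactor (x * y) * downUp x y 0 1 s t := by
  -- The summed relation alone does not survive the induction: the (0,0) and (1,1) terms are scaled
  -- differently, by 1 and `x * y`. The term `downUp x y 1 1` stands on the left because ℝ≥0∞ has no
  -- subtraction.
  induction s, t using induction₂ with
  | empty =>
    simp [upDown_empty_of_eq_zero, upDown_empty_one_zero, upDown_empty_one_one, downUp_empty]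
  | cons l m s t ih =>
    obtain ⟨⟨h00, h11⟩, h01, h10⟩ := ih
    have hu := geom_mul (x * y)
    have hsum := add_eq_cauchyFactor_mul h00 h11
    have F00 := upDown_consBit x y (a := 0) (b := 0) (by simp) (by simp) l m s t
    have F11 := upDown_consBit x y (a := 1) (b := 1) (by simp) (by simp) l m s t
    have F01 := upDown_consBit x y (a := 0) (b := 1) (by simp) (by simp) l m s t
    have F10 := upDown_consBit x y (a := 1) (b := 0) (by simp) (by simp) l m s t
    have G00 := downUp_consBit x y (a := 0) (b := 0) (by simp) (by simp) l m s t
    have G11 := downUp_consBit x y (a := 1) (b := 1) (by simp) (by simp) l m s t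
    have G01 := downUp_consBit x y (a := 0) (b := 1) (by simp) (by simp) l m s t
    have G10 := downUp_consBit x y (a := 1) (b := 0) (by simp) (by simp) l m s t
    unfold cauchyFactor at *
    -- Terms with an index outside {0, 1} vanish. For `l = m` each type of relation follows from its
    -- own type; for `l ≠ m` the types with equal and with unequal indices are exchanged, and `hsum`
    -- supplies the nontrivial unequal one.
    cases l <;> cases m <;>
      simp [upDown_eq_zero, downUp_eq_zero] at F00 F11 F01 F10 G00 G11 G01 G10 <;>
      rw [F00, F11, F01, F10, G00, G11, G01, G10] <;>
      generalize geom (x * y) = u at * <;>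
      generalize downUp x y 0 0 s t = g00 at * <;>
      generalize downUp x y 1 1 s t = g11 at * <;>
      generalize upDown x y 0 0 s t = f00 at * <;>
      generalize upDown x y 1 1 s t = f11 at * <;>
      generalize upDown x y 1 0 s t = f10 at * <;>
      generalize upDown x y 0 1 s t = f01 at * <;>
      generalize downUp x y 0 1 s t = g01 at * <;>
      generalize downUp x y 1 0 s t = g10 at *
    · refine ⟨⟨?_, ?_⟩, by rw [h01]; ring, by rw [h10]; ring⟩
      · rw [h00, mul_assoc, hu g11]; ring
      · calc
          _ = x * y * (f11 + g11) + 2 * (x * y) * f00 := by ring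
          _ = 2 * (x * y) * (g00 + x * y * u * g00) + 4 * (x * y) * u * g11 := by
            rw [h11, h00]; ring
          _ = _ := by rw [← hu g00]; ring
    · refine ⟨⟨by rw [h01]; ring, ?_⟩, by ring, ?_⟩
      · calc
          _ = 4 * (x * y) * (g10 + x * y * u * g10) := by rw [h01]; ring
          _ = _ := by rw [← hu g10]; ring
      · calc
          _ = 2 * x * (f00 + f11) := by ring
          _ = _ := by rw [hsum]; ring
    · refine ⟨⟨by rw [h10]; ring, ?_⟩, ?_, by ring⟩
      · calc
          _ = 2 * (x * y) * (g01 + x * y * u * g01) := by rw [h10]; ring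
          _ = _ := by rw [← hu g01]; ring
      · calc
          _ = y * (f00 + f11) := by ring
          _ = _ := by rw [hsum]; ring
    · refine ⟨⟨?_, ?_⟩, by rw [h01]; ring, by rw [h10]; ring⟩
      · calc
          _ = 2 * f11 + g00 + 2 * (u * g11) := by rw [h00]; ring
          _ = 2 * (f11 + g11) + g00 + 2 * (x * y) * u * g11 := by rw [hu g11]; ring
          _ = _ := by rw [h11]; ring
      · calc
          _ = x * y * (f11 + g11) + 2 * (x * y) * g00 := by ring
          _ = 2 * (x * y) * (g00 + x * y * u * g00) := by rw [h11]; ring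
          _ = _ := by rw [← hu g00]; ring

/-- Commutation of an upward with a downward step. -/
lemma formalSum_upWeight_mul_downWeight (x y : ℝ≥0∞⟦X⟧) (s t : Finset ℕ) :
    formalSum (fun ν => upWeight x s ν * downWeight y ν t) =
      cauchyFactor (x * y) * formalSum fun κ => downWeight y s κ * upWeight x κ t := by
  have h₁ : formalSum (fun ν => upWeight x s ν * downWeight y ν t) =
      upDown x y 0 0 s t + upDown x y 0 1 s t + upDown x y 1 0 s t + upDown x y 1 1 s t := by
    simp only [upDown, ← formalSum_add, upWeight_eq, downWeight_eq]
    congr 1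
    funext ν
    ring
  have h₂ : formalSum (fun κ => downWeight y s κ * upWeight x κ t) =
      downUp x y 0 0 s t + downUp x y 0 1 s t + downUp x y 1 0 s t + downUp x y 1 1 s t := by
    simp only [downUp, ← formalSum_add, upWeight_eq, downWeight_eq]
    congr 1
    funext ν
    ring
  obtain ⟨⟨h00, h11⟩, h01, h10⟩ := upDown_downUp x y s t
  rw [h₁, h₂, h01, h10, add_right_comm, add_right_comm _ (_ * _),
    add_eq_cauchyFactor_mul h00 h11]
  ring

end StrictPartition

namespace StrictPartition

/-! ### Chains of strict partitions and the Cauchy identity -/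

/-- The weighted sum over all chains of `n` steps from `s` to the empty partition, the `k`-th step
having weight `w k`. -/
noncomputable def chainSum :
    ℕ → (ℕ → Finset ℕ → Finset ℕ → ℝ≥0∞⟦X⟧) → Finset ℕ → ℝ≥0∞⟦X⟧
  | 0, _, s => if s = ∅ then 1 else 0
  | n + 1, w, s => formalSum fun t => w 0 s t * chainSum n (fun k => w (k + 1)) t

/-- Sequences of strict partitions that are empty from the index `N` on. -/
abbrev Chain (N : ℕ) : Type := {C : ℕ → Finset ℕ // ∀ n, N ≤ n → C n = ∅}

/-- Splitting off the first term of a chain. -/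
def chainEquiv (N : ℕ) : Finset ℕ × Chain N ≃ Chain (N + 1) where
  toFun p := ⟨fun n => n.casesOn p.1 p.2.1, fun n hn => by
    obtain ⟨n, rfl⟩ := Nat.exists_eq_succ_of_ne_zero (show n ≠ 0 by omega)
    exact p.2.2 n (by omega)⟩
  invFun C := (C.1 0, ⟨fun n => C.1 (n + 1), fun n hn => C.2 _ (by omega)⟩)
  left_inv p := rfl
  right_inv C := by
    ext n : 2
    cases n <;> rfl

lemma chainEquiv_zero {N : ℕ} (p : Finset ℕ × Chain N) : (chainEquiv N p).1 0 = p.1 := rfl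

lemma chainEquiv_succ {N : ℕ} (p : Finset ℕ × Chain N) (n : ℕ) :
    (chainEquiv N p).1 (n + 1) = p.2.1 n := rfl

lemma chainSum_eq (N : ℕ) (w : ℕ → Finset ℕ → Finset ℕ → ℝ≥0∞⟦X⟧) (s : Finset ℕ) :
    chainSum N w s = formalSum fun C : Chain N =>
      (if C.1 0 = s then 1 else 0) * ∏ n ∈ Finset.range N, w n (C.1 n) (C.1 (n + 1)) := by
  induction N generalizing w s with
  | zero =>
    rw [formalSum_eq_single ⟨fun _ => ∅, fun _ _ => rfl⟩]
    · simp [chainSum, eq_comm]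
    · rintro ⟨C, hC⟩ h
      exact absurd (Subtype.ext (funext fun n => hC n (Nat.zero_le n))) h
  | succ N ih =>
    rw [← formalSum_equiv (chainEquiv N), formalSum_prod, formalSum_eq_single s, chainSum]
    · simp only [ih, ← formalSum_mul_left]
      rw [formalSum_comm]
      congr 1
      funext C
      rw [formalSum_eq_single (C.1 0)]
      · simp only [if_true, one_mul, Finset.prod_range_succ', chainEquiv_zero, chainEquiv_succ]
        ring
      · intro t ht
        rw [if_neg (Ne.symm ht)]
        ring
    · intro t ht
      convert formalSum_zero with C
      rw [if_neg, zero_mul]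
      exact ht

lemma downWeight_empty (y : ℝ≥0∞⟦X⟧) (t : Finset ℕ) :
    downWeight y ∅ t = if t = ∅ then 1 else 0 := by
  unfold downWeight
  simp only [interlace_empty_right]
  split_ifs with h
  · simp [h]
  · rfl

lemma upWeight_empty (x : ℝ≥0∞⟦X⟧) (t : Finset ℕ) :
    upWeight x t ∅ = if t = ∅ then 1 else 0 := by
  unfold upWeight
  simp only [interlace_empty_right]
  split_ifs with h
  · simp [h]
  · rfl

/-- Up steps are read backwards here, from larger to smaller partitions, so a chain starting at the
empty partition stays there. -/
lemma chainSum_upWeight_empty (m : ℕ) (x : ℕ → ℝ≥0∞⟦X⟧) :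
    chainSum m (fun i s t => upWeight (x i) t s) ∅ = 1 := by
  induction m generalizing x with
  | zero => simp [chainSum]
  | succ m ih =>
    rw [chainSum, formalSum_eq_single ∅]
    · rw [ih fun i => x (i + 1), upWeight_empty]
      simp
    · intro t ht
      rw [upWeight_empty, if_neg ht, zero_mul]

/-- The down step is moved past the `m` up steps one at a time; once it starts at the empty
partition it is trivial. -/
lemma formalSum_chainSum_mul_downWeight (m : ℕ) (x : ℕ → ℝ≥0∞⟦X⟧) (y : ℝ≥0∞⟦X⟧)
    (t : Finset ℕ) :
    formalSum (fun ν => chainSum m (fun i s t => upWeight (x i) t s) ν * downWeight y ν t) =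
      (∏ i ∈ Finset.range m, cauchyFactor (x i * y)) *
        chainSum m (fun i s t => upWeight (x i) t s) t := by
  induction m generalizing x t with
  | zero =>
    rw [formalSum_eq_single ∅]
    · simp [chainSum, downWeight_empty]
    · intro s hs
      simp [chainSum, hs]
  | succ m ih =>
    simp only [chainSum, ← formalSum_mul_right]
    rw [formalSum_comm]
    calc
      _ = formalSum fun s => chainSum m (fun i s t => upWeight (x (i + 1)) t s) s *
            formalSum fun ν => upWeight (x 0) s ν * downWeight y ν t := by
          simp only [← formalSum_mul_left]
          congr! 4 with s ν
          ring
      _ = cauchyFactor (x 0 * y) * formalSum fun κ => upWeight (x 0) κ t *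
            formalSum fun s => chainSum m (fun i s t => upWeight (x (i + 1)) t s) s *
              downWeight y s κ := by
          simp only [formalSum_upWeight_mul_downWeight, ← formalSum_mul_left]
          rw [formalSum_comm]
          congr! 4 with s κ
          ring
      _ = _ := by
          simp only [ih fun i => x (i + 1), Finset.prod_range_succ', ← formalSum_mul_left]
          congr! 2 with κ
          ring

/-- The Cauchy identity for chains of strict partitions. -/
lemma formalSum_chainSum_mul_chainSum (m n : ℕ) (x y : ℕ → ℝ≥0∞⟦X⟧) :
    formalSum (fun s => chainSum m (fun i s t => upWeight (x i) t s) s *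
        chainSum n (fun j s t => downWeight (y j) s t) s) =
      ∏ j ∈ Finset.range n, ∏ i ∈ Finset.range m, cauchyFactor (x i * y j) := by
  induction n generalizing y with
  | zero =>
    rw [formalSum_eq_single ∅]
    · simp [chainSum, chainSum_upWeight_empty]
    · intro s hs
      simp [chainSum, hs]
  | succ n ih =>
    rw [Finset.prod_range_succ', ← ih fun j => y (j + 1)]
    simp only [chainSum, ← formalSum_mul_left]
    rw [formalSum_comm]
    simp only [← mul_assoc, formalSum_mul_right, formalSum_chainSum_mul_downWeight]
    rw [← formalSum_mul_right]
    congr! 2 with s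
    ring

open Classical in
/-- The Cauchy identity as a sum over pairs of chains with a common first term. -/
lemma formalSum_chain_pair (m n : ℕ) (x y : ℕ → ℝ≥0∞⟦X⟧) :
    formalSum (fun p : Chain m × Chain n => if p.1.1 0 = p.2.1 0 then
        (∏ i ∈ Finset.range m, upWeight (x i) (p.1.1 (i + 1)) (p.1.1 i)) *
          ∏ j ∈ Finset.range n, downWeight (y j) (p.2.1 j) (p.2.1 (j + 1)) else 0) =
      ∏ j ∈ Finset.range n, ∏ i ∈ Finset.range m, cauchyFactor (x i * y j) := by
  rw [← formalSum_chainSum_mul_chainSum, formalSum_prod]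
  simp only [chainSum_eq, ← formalSum_mul_left, ← formalSum_mul_right]
  rw [formalSum_comm]
  conv_rhs => rw [formalSum_comm]
  congr 1
  funext D
  rw [formalSum_comm]
  congr 1
  funext C
  rw [formalSum_eq_single (D.1 0)]
  · by_cases h : C.1 0 = D.1 0 <;> simp [h]
  · intro s hs
    rw [if_neg (Ne.symm hs)]
    ring

end StrictPartition

/-! ### Parts of a strict partition -/

lemma Finset.mem_iff_lt_card_of_isLowerSet {B : Finset ℕ}
    (hB : ∀ i ∈ B, ∀ j ≤ i, j ∈ B) (i : ℕ) : i ∈ B ↔ i < B.card := by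
  constructor
  · intro hi
    have : Finset.range (i + 1) ⊆ B := fun j hj =>
      hB i hi j (by simpa [Nat.lt_succ_iff] using hj)
    simpa using Finset.card_le_card this
  · intro h
    by_contra hi
    have : B ⊆ Finset.range i := fun j hj => by
      by_contra hij
      exact hi (hB j hj i (by simpa using hij))
    have := Finset.card_le_card this
    rw [Finset.card_range] at this
    omega

namespace StrictPartition

lemma tailCard_anti (s : Finset ℕ) {h k : ℕ} (hk : h ≤ k) : tailCard s k ≤ tailCard s h := by
  apply Finset.card_le_card
  intro i
  simp only [Finset.mem_filter]
  exact fun ⟨h₁, h₂⟩ => ⟨h₁, hk.trans h₂⟩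

lemma tailCard_eq (s : Finset ℕ) (h : ℕ) :
    tailCard s h = tailCard s (h + 1) + if h ∈ s then 1 else 0 := by
  simp only [tailCard, Finset.card_filter]
  rw [← Finset.sum_ite_eq' s h fun _ => 1, ← Finset.sum_add_distrib]
  refine Finset.sum_congr rfl fun i _ => ?_
  split_ifs <;> omega

/-- The `i`-th largest part of a strict partition, or `0`. -/
def part (s : Finset ℕ) (i : ℕ) : ℕ :=
  ((Finset.range (s.sup id + 1)).filter fun h => i < tailCard s h).card

/-- Parts and tail counts are conjugate: both sides say that the box (i, h) lies in the Young
diagram. -/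
lemma lt_part {s : Finset ℕ} {i h : ℕ} : h < part s i ↔ i < tailCard s h := by
  rw [part, ← Finset.mem_iff_lt_card_of_isLowerSet]
  · simp only [Finset.mem_filter, Finset.mem_range, and_iff_right_iff_imp]
    intro hi
    obtain ⟨j, hj⟩ := Finset.card_pos.1 (show 0 < (s.filter (h ≤ ·)).card from by
      unfold tailCard at hi; omega)
    rw [Finset.mem_filter] at hj
    have := Finset.le_sup (f := id) hj.1
    simp only [id] at this
    omega
  · simp only [Finset.mem_filter, Finset.mem_range]
    rintro k ⟨hk, hk'⟩ j hj
    exact ⟨by omega, hk'.trans_le (tailCard_anti s hj)⟩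

lemma exists_part_eq_succ {s : Finset ℕ} {h : ℕ} : (∃ i, part s i = h + 1) ↔ h ∈ s := by
  have key (i : ℕ) : part s i = h + 1 ↔ tailCard s (h + 1) ≤ i ∧ i < tailCard s h := by
    rw [← lt_part, ← not_lt, ← lt_part]
    omega
  simp only [key]
  have := tailCard_eq s h
  constructor
  · rintro ⟨i, h₁, h₂⟩
    by_contra hs
    rw [if_neg hs] at this
    omega
  · intro hs
    rw [if_pos hs] at this
    -- The index of the part `h + 1` is the number of larger parts.
    exact ⟨tailCard s (h + 1), le_rfl, by omega⟩

lemma part_injective {s : Finset ℕ} {i j : ℕ} (hi : 0 < part s i) (hij : part s i = part s j) :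
    i = j := by
  obtain ⟨a, ha⟩ := Nat.exists_eq_succ_of_ne_zero hi.ne'
  have hi₁ : a < part s i := by omega
  have hi₂ : ¬ a + 1 < part s i := by omega
  have hj₁ : a < part s j := by omega
  have hj₂ : ¬ a + 1 < part s j := by omega
  rw [lt_part] at hi₁ hi₂ hj₁ hj₂
  have := tailCard_eq s a
  split_ifs at this <;> omega

end StrictPartition

/-! ### Diagonals of a plane partition -/

namespace PlanePartition

open StrictPartition

/-- The diagonal on which a position lies. -/
def content (c : ℕ × ℕ) : ℤ := (c.2 : ℤ) - c.1

/-- The `i`-th position on the diagonal `k`. -/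
def diagCell (k : ℤ) (i : ℕ) : ℕ × ℕ := (i + (-k).toNat, i + k.toNat)

lemma diagCell_content (c : ℕ × ℕ) : diagCell (content c) (min c.1 c.2) = c := by
  ext <;> simp only [diagCell, content] <;> omega

lemma content_diagCell (k : ℤ) (i : ℕ) : content (diagCell k i) = k := by
  simp only [diagCell, content]
  omega

lemma min_diagCell (k : ℤ) (i : ℕ) : min (diagCell k i).1 (diagCell k i).2 = i := by
  simp only [diagCell]
  omega

lemma diagCell_mono (k : ℤ) : Monotone (diagCell k) := by
  intro i j hij
  constructor <;> simp only [diagCell] <;> omega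

/-- The parts, decreased by one, of the slice of `π` along the diagonal `k`. -/
def diagSet (π : PlanePartition) (k : ℤ) : Finset ℕ :=
  (π.height.support.filter fun c => content c = k).image fun c => π.height c - 1

lemma mem_diagSet {π : PlanePartition} {k : ℤ} {h : ℕ} :
    h ∈ π.diagSet k ↔ ∃ c, content c = k ∧ π.height c = h + 1 := by
  simp only [diagSet, Finset.mem_image, Finset.mem_filter, Finsupp.mem_support_iff]
  constructor
  · rintro ⟨c, ⟨h₁, h₂⟩, h₃⟩
    exact ⟨c, h₂, by omega⟩
  · rintro ⟨c, h₁, h₂⟩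
    exact ⟨c, ⟨by omega, h₁⟩, by omega⟩

/-- The positions of height above `h` form an initial segment of the diagonal, and strictness
ensures that passing to the set of heights loses no multiplicity. -/
lemma DiagonallyStrict.lt_tailCard_diagSet {π : PlanePartition} (hπ : π.DiagonallyStrict) (k : ℤ)
    (h i : ℕ) : i < tailCard (π.diagSet k) h ↔ h < π.height (diagCell k i) := by
  classical
  set A := π.height.support.filter fun c => content c = k ∧ h < π.height c with hA
  have h₁ : tailCard (π.diagSet k) h = A.card := by
    have : (π.diagSet k).filter (h ≤ ·) = A.image fun c => π.height c - 1 := by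
      ext n
      simp only [Finset.mem_filter, mem_diagSet, hA, Finset.mem_image, Finsupp.mem_support_iff]
      constructor
      · rintro ⟨⟨c, hc, hc'⟩, hn⟩
        exact ⟨c, ⟨by omega, hc, by omega⟩, by omega⟩
      · rintro ⟨c, ⟨h₁, h₂, h₃⟩, h₄⟩
        exact ⟨⟨c, h₂, by omega⟩, by omega⟩
    rw [tailCard, this, Finset.card_image_of_injOn]
    intro c hc d hd hcd
    simp only [hA, Finset.coe_filter, Finsupp.mem_support_iff, Set.mem_ofPred_eq] at hc hd hcd
    exact hπ c d (hc.2.1.trans hd.2.1.symm) (by omega) (by omega)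
  have h₂ : A.card = (A.image fun c => min c.1 c.2).card := by
    rw [Finset.card_image_of_injOn]
    intro c hc d hd hcd
    simp only [hA, Finset.coe_filter, Finsupp.mem_support_iff, Set.mem_ofPred_eq] at hc hd hcd
    rw [← diagCell_content c, ← diagCell_content d, hc.2.1, hd.2.1, hcd]
  have h₃ (j : ℕ) : j ∈ (A.image fun c => min c.1 c.2) ↔ h < π.height (diagCell k j) := by
    simp only [hA, Finset.mem_filter, Finset.mem_image, Finsupp.mem_support_iff]
    constructor
    · rintro ⟨c, ⟨-, rfl, hc⟩, rfl⟩
      rwa [diagCell_content]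
    · intro hj
      exact ⟨diagCell k j, ⟨by omega, content_diagCell k j, hj⟩, min_diagCell k j⟩
  rw [h₁, h₂, ← Finset.mem_iff_lt_card_of_isLowerSet, h₃]
  intro i hi j hj
  rw [h₃] at hi ⊢
  exact hi.trans_le (π.antitone_height (diagCell_mono k hj))

lemma DiagonallyStrict.interlace_diagSet {π : PlanePartition} (hπ : π.DiagonallyStrict) {k l : ℤ}
    (h₁ : ∀ i, diagCell k i ≤ diagCell l i) (h₂ : ∀ i, diagCell l i ≤ diagCell k (i + 1)) :
    Interlace (π.diagSet l) (π.diagSet k) := by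
  intro h
  constructor
  · by_contra! hlt
    have := (hπ.lt_tailCard_diagSet l h _).1 hlt
    have := this.trans_le (π.antitone_height (h₁ _))
    rw [← hπ.lt_tailCard_diagSet] at this
    omega
  · by_contra! hlt
    have := (hπ.lt_tailCard_diagSet k h _).1 hlt
    have := this.trans_le (π.antitone_height (h₂ _))
    rw [← hπ.lt_tailCard_diagSet] at this
    omega

lemma DiagonallyStrict.interlace_diagSet_nat {π : PlanePartition} (hπ : π.DiagonallyStrict)
    (n : ℕ) : Interlace (π.diagSet (n + 1 : ℕ)) (π.diagSet n) := by
  refine hπ.interlace_diagSet (fun i => ?_) fun i => ?_ <;> constructor <;>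
    simp only [diagCell] <;> omega

lemma DiagonallyStrict.interlace_diagSet_neg {π : PlanePartition} (hπ : π.DiagonallyStrict)
    (n : ℕ) : Interlace (π.diagSet (-(n + 1 : ℕ))) (π.diagSet (-n)) := by
  refine hπ.interlace_diagSet (fun i => ?_) fun i => ?_ <;> constructor <;>
    simp only [diagCell] <;> omega

lemma DiagonallyStrict.ext_diagSet {π ρ : PlanePartition} (hπ : π.DiagonallyStrict)
    (hρ : ρ.DiagonallyStrict) (h : ∀ k, π.diagSet k = ρ.diagSet k) : π = ρ := by
  have : π.height = ρ.height := by
    ext c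
    rw [← diagCell_content c]
    refine Nat.le_antisymm (le_of_forall_lt fun n hn => ?_) (le_of_forall_lt fun n hn => ?_)
    · rwa [← hρ.lt_tailCard_diagSet, ← h, hπ.lt_tailCard_diagSet]
    · rwa [← hπ.lt_tailCard_diagSet, h, hρ.lt_tailCard_diagSet]
  cases π
  cases ρ
  simp_all

/-- Diagonals far from the main one are empty. -/
def DiagBounded (N : ℕ) (π : PlanePartition) : Prop :=
  ∀ c, (N : ℤ) ≤ |content c| → π.height c = 0

lemma DiagBounded.diagSet_eq_empty {N : ℕ} {π : PlanePartition} (hπ : π.DiagBounded N) {k : ℤ}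
    (hk : (N : ℤ) ≤ |k|) : π.diagSet k = ∅ := by
  apply Finset.eq_empty_of_forall_notMem
  intro h hh
  obtain ⟨c, rfl, hc⟩ := mem_diagSet.1 hh
  have := hπ c hk
  omega

/-- A sequence of strict partitions, indexed by the diagonals and interlacing outwards, consists
of the diagonal slices of a diagonally strict plane partition. -/
lemma exists_diagSet_eq {N : ℕ} (D : ℤ → Finset ℕ) (hN : ∀ k : ℤ, (N : ℤ) ≤ |k| → D k = ∅)
    (hpos : ∀ n : ℕ, Interlace (D (n + 1 : ℕ)) (D n))
    (hneg : ∀ n : ℕ, Interlace (D (-(n + 1 : ℕ))) (D (-n))) :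
    ∃ π : PlanePartition, π.DiagonallyStrict ∧ π.DiagBounded N ∧ ∀ k, π.diagSet k = D k := by
  have hcard_pos (n : ℕ) : (D n).card ≤ (D 0).card := by
    induction n with
    | zero => simp
    | succ n ih => exact (hpos n).card_le.1.trans ih
  have hcard_neg (n : ℕ) : (D (-n)).card ≤ (D 0).card := by
    induction n with
    | zero => simp
    | succ n ih => exact (hneg n).card_le.1.trans ih
  have hcard (k : ℤ) : (D k).card ≤ (D 0).card := by
    obtain ⟨n, rfl | rfl⟩ := k.eq_nat_or_neg
    · exact hcard_pos n
    · exact hcard_neg n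
  let f : ℕ × ℕ → ℕ := fun c => part (D (content c)) (min c.1 c.2)
  have hbd (c : ℕ × ℕ) (hc : (N : ℤ) ≤ |content c|) : f c = 0 := by
    by_contra h
    have := lt_part.1 (Nat.pos_of_ne_zero h)
    simp [hN _ hc, tailCard_empty] at this
  have hfin : f.support.Finite := by
    -- On the support the smaller coordinate is below `(D 0).card`, as no slice has more parts than
    -- the central one, and the coordinates differ by less than `N`.
    refine (Set.finite_Iic ((D 0).card + N, (D 0).card + N)).subset fun c hc => ?_
    have h₁ : |content c| < (N : ℤ) := by
      by_contra h
      exact hc (hbd c (by omega))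
    have h₂ := lt_part.1 (Nat.pos_of_ne_zero hc)
    rw [tailCard_zero] at h₂
    have h₃ := hcard (content c)
    rw [abs_lt] at h₁
    simp only [content] at h₁ h₂ h₃
    constructor <;> simp only <;> omega
  have hle {c d : ℕ × ℕ} (h : ∀ n, min d.1 d.2 < tailCard (D (content d)) n →
      min c.1 c.2 < tailCard (D (content c)) n) : f d ≤ f c :=
    le_of_forall_lt fun n hn => lt_part.2 (h n (lt_part.1 hn))
  have hrow (i j : ℕ) : f (i, j + 1) ≤ f (i, j) := by
    refine hle fun n hn => ?_
    -- A step away from the main diagonal uses the first inequality of interlacing; a step towards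
    -- it raises the index on the diagonal by one and uses the second.
    rcases le_or_gt i j with hij | hij
    · have h := hpos (j - i) n
      rw [show content (i, j + 1) = ((j - i + 1 : ℕ) : ℤ) by simp only [content]; omega] at hn
      rw [show content (i, j) = ((j - i : ℕ) : ℤ) by simp only [content]; omega]
      simp only at *
      omega
    · have h := hneg (i - j - 1) n
      rw [show content (i, j + 1) = -((i - j - 1 : ℕ) : ℤ) by simp only [content]; omega] at hn
      rw [show content (i, j) = -((i - j - 1 + 1 : ℕ) : ℤ) by simp only [content]; omega]
      simp only at *
      omega
  have hcol (i j : ℕ) : f (i + 1, j) ≤ f (i, j) := by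
    refine hle fun n hn => ?_
    rcases le_or_gt j i with hij | hij
    · have h := hneg (i - j) n
      rw [show content (i + 1, j) = -((i - j + 1 : ℕ) : ℤ) by simp only [content]; omega] at hn
      rw [show content (i, j) = -((i - j : ℕ) : ℤ) by simp only [content]; omega]
      simp only at *
      omega
    · have h := hpos (j - i - 1) n
      rw [show content (i + 1, j) = ((j - i - 1 : ℕ) : ℤ) by simp only [content]; omega] at hn
      rw [show content (i, j) = ((j - i - 1 + 1 : ℕ) : ℤ) by simp only [content]; omega]
      simp only at *
      omega
  have hanti : Antitone f := by
    rintro ⟨i, j⟩ ⟨i', j'⟩ ⟨hi, hj⟩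
    exact (antitone_nat_of_succ_le (f := fun n => f (n, j')) (fun n => hcol n j') hi).trans
      (antitone_nat_of_succ_le (f := fun n => f (i, n)) (fun n => hrow i n) hj)
  refine ⟨⟨Finsupp.ofSupportFinite f hfin, hanti⟩, ?_, hbd, fun k => ?_⟩
  · intro c d hcd hc hcd'
    change content c = content d at hcd
    change 0 < f c at hc
    change f c = f d at hcd'
    simp only [f] at hc hcd'
    rw [hcd] at hc hcd'
    rw [← diagCell_content c, ← diagCell_content d, hcd, part_injective hc hcd']
  · ext h
    rw [mem_diagSet, ← exists_part_eq_succ]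
    constructor
    · rintro ⟨c, rfl, hc⟩
      exact ⟨_, hc⟩
    · rintro ⟨i, hi⟩
      refine ⟨diagCell k i, content_diagCell k i, ?_⟩
      change f _ = _
      simp only [f]
      rwa [content_diagCell, min_diagCell]

end PlanePartition

namespace PlanePartition

open StrictPartition

/-! ### Paths of a plane partition -/

lemma neighbour_content {c d : ℕ × ℕ} (h : Neighbour c d) :
    content d = content c + 1 ∨ content d = content c - 1 := by
  simp only [Neighbour, content] at *
  omega

lemma DiagonallyStrict.eq_of_adj {π : PlanePartition} (hπ : π.DiagonallyStrict) {c d e : π.Cell}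
    (hd : π.pathGraph.Adj c d) (he : π.pathGraph.Adj c e) (h : content d.1 = content e.1) :
    d = e :=
  Subtype.ext (hπ d.1 e.1 h d.2 (hd.2.symm.trans he.2))

/-- At a vertex of maximal content on a cycle, both cycle neighbours lie on the preceding diagonal
with equal height, hence coincide. -/
lemma DiagonallyStrict.isAcyclic_pathGraph {π : PlanePartition} (hπ : π.DiagonallyStrict) :
    π.pathGraph.IsAcyclic := by
  classical
  intro u p hp
  obtain ⟨m, hm, hmax⟩ := Finset.exists_max_image p.support.toFinset
    (fun c : π.Cell => content c.1) ⟨u, by simp⟩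
  rw [List.mem_toFinset] at hm
  have hq := hp.rotate hm
  have key : ∀ d ∈ (p.rotate m hm).support, π.pathGraph.Adj m d → content d.1 = content m.1 - 1 := by
    intro d hd hadj
    have := hmax d (by
      rw [List.mem_toFinset]
      exact (p.mem_support_rotate_iff m hm).1 hd)
    have := neighbour_content hadj.1
    omega
  have hadj₁ := (p.rotate m hm).adj_snd hq.not_nil
  have hadj₂ := ((p.rotate m hm).adj_penultimate hq.not_nil).symm
  refine hq.snd_ne_penultimate (hπ.eq_of_adj hadj₁ hadj₂ ?_)
  rw [key _ (SimpleGraph.Walk.getVert_mem_support _ _) hadj₁,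
    key _ (SimpleGraph.Walk.getVert_mem_support _ _) hadj₂]

/-- Equal heights at two positions of a diagonal force, by monotonicity, a constant 2 × 2 block at
the upper one; its opposite corners are joined by two paths. -/
lemma OneColumnWide.diagonallyStrict {π : PlanePartition} (hπ : π.OneColumnWide) :
    π.DiagonallyStrict := by
  have key : ∀ c d : ℕ × ℕ, (c.2 : ℤ) - c.1 = (d.2 : ℤ) - d.1 → 0 < π.height c →
      π.height c = π.height d → ¬ c.1 < d.1 := by
    rintro ⟨i, j⟩ ⟨k, l⟩ hcd hpos hh hlt
    simp only at hcd hlt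
    have h₁ : π.height (i + 1, j + 1) ≤ π.height (i, j + 1) :=
      π.antitone_height ⟨by simp, le_rfl⟩
    have h₂ : π.height (i, j + 1) ≤ π.height (i, j) := π.antitone_height ⟨le_rfl, by simp⟩
    have h₃ : π.height (i + 1, j + 1) ≤ π.height (i + 1, j) :=
      π.antitone_height ⟨le_rfl, by simp⟩
    have h₄ : π.height (i + 1, j) ≤ π.height (i, j) := π.antitone_height ⟨by simp, le_rfl⟩
    have h₅ : π.height (k, l) ≤ π.height (i + 1, j + 1) :=
      π.antitone_height ⟨by simp only; omega, by simp only; omega⟩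
    let c : π.Cell := ⟨(i, j), hpos⟩
    let a : π.Cell := ⟨(i, j + 1), by omega⟩
    let b : π.Cell := ⟨(i + 1, j), by omega⟩
    let e : π.Cell := ⟨(i + 1, j + 1), by omega⟩
    have hca : π.pathGraph.Adj c a := ⟨by simp [Neighbour, c, a], by simp only [c, a]; omega⟩
    have hae : π.pathGraph.Adj a e := ⟨by simp [Neighbour, e, a], by simp only [e, a]; omega⟩
    have hcb : π.pathGraph.Adj c b := ⟨by simp [Neighbour, c, b], by simp only [c, b]; omega⟩
    have hbe : π.pathGraph.Adj b e := ⟨by simp [Neighbour, e, b], by simp only [e, b]; omega⟩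
    have hce : c ≠ e := by simp [c, e]
    have := hπ c e ⟨.cons hca (.cons hae .nil), by simp [hca.ne, hae.ne, hce]⟩
      ⟨.cons hcb (.cons hbe .nil), by simp [hcb.ne, hbe.ne, hce]⟩
    have := congrArg (fun p : π.pathGraph.Path c e => p.1.snd) this
    simp [a, b] at this
  intro c d hcd hpos hh
  have h₁ := key c d hcd hpos hh
  have h₂ := key d c hcd.symm (hh ▸ hpos) hh.symm
  ext <;> omega

/-- A plane partition is diagonally strict if and only if its paths are one column wide. -/
lemma diagonallyStrict_iff_oneColumnWide (π : PlanePartition) :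
    π.DiagonallyStrict ↔ π.OneColumnWide :=
  ⟨fun h c d => (SimpleGraph.isAcyclic_iff_subsingleton_path.1 h.isAcyclic_pathGraph c d).elim,
    OneColumnWide.diagonallyStrict⟩

/-! ### Counting paths by their first columns -/

/-- The first columns of the paths: no column of the same height on the preceding diagonal. -/
def firstCells (π : PlanePartition) : Finset (ℕ × ℕ) :=
  π.height.support.filter fun c => π.height c - 1 ∉ π.diagSet (content c - 1)

/-- Otherwise the position diagonally next to `c` on the side of `d` would be squeezed between them
and share the height of `c`. -/
lemma DiagonallyStrict.neighbour_of_height_eq {π : PlanePartition} (hπ : π.DiagonallyStrict)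
    {c d : ℕ × ℕ} (hc : 0 < π.height c) (hcd : content d = content c - 1)
    (hh : π.height c = π.height d) : Neighbour c d := by
  obtain ⟨i, j⟩ := c
  obtain ⟨k, l⟩ := d
  simp only [content] at hcd
  rcases lt_or_ge (i + 1) k with h | h
  · have h₁ : π.height (i + 1, j + 1) ≤ π.height (i, j) :=
      π.antitone_height ⟨by simp, by simp⟩
    have h₂ : π.height (k, l) ≤ π.height (i + 1, j + 1) :=
      π.antitone_height ⟨by simp only; omega, by simp only; omega⟩
    have := hπ (i, j) (i + 1, j + 1) (by push_cast; ring) hc (by omega)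
    simp at this
  rcases lt_or_ge k i with h' | h'
  · have h₁ : π.height (i, j) ≤ π.height (i - 1, j - 1) :=
      π.antitone_height ⟨by simp, by simp⟩
    have h₂ : π.height (i - 1, j - 1) ≤ π.height (k, l) :=
      π.antitone_height ⟨by simp only; omega, by simp only; omega⟩
    have := hπ (i, j) (i - 1, j - 1) (by simp only; omega) hc (by omega)
    simp only [Prod.mk.injEq] at this
    omega
  · simp only [Neighbour]
    omega

lemma DiagonallyStrict.exists_adj_iff {π : PlanePartition} (hπ : π.DiagonallyStrict)
    (c : π.Cell) : (∃ d, π.pathGraph.Adj c d ∧ content d.1 = content c.1 - 1) ↔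
      π.height c.1 - 1 ∈ π.diagSet (content c.1 - 1) := by
  have hc := c.2
  rw [mem_diagSet]
  constructor
  · rintro ⟨d, hd, hcd⟩
    exact ⟨d.1, hcd, by have := hd.2; omega⟩
  · rintro ⟨d, hcd, hd⟩
    have hh : π.height c.1 = π.height d := by omega
    exact ⟨⟨d, by omega⟩, ⟨hπ.neighbour_of_height_eq hc hcd hh, hh⟩, hcd⟩

instance (π : PlanePartition) : Finite π.Cell :=
  (π.height.support.finite_toSet.subset fun c hc => by
    simpa [Nat.pos_iff_ne_zero] using hc : Set.Finite {c | 0 < π.height c}).to_subtype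

/-- Every column reachable from the first column of a path is reached by steps to the next
diagonal. -/
lemma DiagonallyStrict.reflTransGen_of_reachable {π : PlanePartition} (hπ : π.DiagonallyStrict)
    {c d : π.Cell} (hc : ¬ ∃ e, π.pathGraph.Adj c e ∧ content e.1 = content c.1 - 1)
    (hcd : π.pathGraph.Reachable c d) :
    Relation.ReflTransGen
      (fun a b : π.Cell => π.pathGraph.Adj a b ∧ content a.1 = content b.1 - 1) c d := by
  rw [SimpleGraph.reachable_iff_reflTransGen] at hcd
  induction hcd with
  | refl => exact .refl
  | @tail a b _ hab ih =>
    rcases neighbour_content hab.1 with h | h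
    · exact ih.tail ⟨hab, by omega⟩
    -- A step back from `a` can only return to the column `e` from which `a` was reached; at `c`
    -- itself there is none.
    · rcases ih.cases_tail with rfl | ⟨e, he, hea⟩
      · exact absurd ⟨b, hab, h⟩ hc
      · rwa [hπ.eq_of_adj hab hea.1.symm (by omega)]

/-- A column of minimal content in a path is a first column. It is the only one, since every other
column is entered from the preceding diagonal. -/
lemma DiagonallyStrict.numPaths_eq_card {π : PlanePartition} (hπ : π.DiagonallyStrict) :
    π.numPaths = π.firstCells.card := by
  have hmem (c : ℕ × ℕ) (hc : c ∈ π.firstCells) : 0 < π.height c := by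
    simp only [firstCells, Finset.mem_filter, Finsupp.mem_support_iff] at hc
    omega
  have hfirst (c : π.Cell) : c.1 ∈ π.firstCells ↔
      ¬ ∃ d, π.pathGraph.Adj c d ∧ content d.1 = content c.1 - 1 := by
    rw [hπ.exists_adj_iff, firstCells, Finset.mem_filter, Finsupp.mem_support_iff]
    exact and_iff_right c.2.ne'
  let f : π.firstCells → π.HPath := fun c =>
    π.pathGraph.connectedComponentMk ⟨c.1, hmem c.1 c.2⟩
  have hf : Function.Bijective f := by
    constructor
    · rintro ⟨c, hc⟩ ⟨d, hd⟩ hcd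
      have hc' := (hfirst ⟨c, hmem c hc⟩).1 hc
      have hd' := (hfirst ⟨d, hmem d hd⟩).1 hd
      have h := hπ.reflTransGen_of_reachable hc' (SimpleGraph.ConnectedComponent.exact hcd)
      rcases h.cases_tail with h | ⟨e, -, he⟩
      · simpa [eq_comm] using h
      · exact absurd ⟨e, he.1.symm, he.2⟩ hd'
    · intro C
      obtain ⟨v, rfl⟩ := C.exists_rep
      obtain ⟨c, hc, hmin⟩ := Set.exists_min_image
        {d : π.Cell | π.pathGraph.Reachable v d} (fun d => content d.1) (Set.toFinite _)
        ⟨v, SimpleGraph.Reachable.refl v⟩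
      refine ⟨⟨c.1, (hfirst c).2 ?_⟩, ?_⟩
      · rintro ⟨d, hd, hcd⟩
        have := hmin d (hc.trans hd.reachable)
        omega
      · exact SimpleGraph.ConnectedComponent.sound hc.symm
  rw [numPaths, ← Nat.card_congr (Equiv.ofBijective f hf)]
  simp

/-! ### Sums over diagonals -/

/-- The main diagonal is grouped with the negative ones, which is why the up parameters are `X ^ (n
+ 1)` and the down parameters `X ^ n`. -/
lemma DiagonallyStrict.sum_support_eq {π : PlanePartition} (hπ : π.DiagonallyStrict) {N : ℕ}
    (hN : π.DiagBounded N) (g : ℤ → ℕ → ℕ) :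
    ∑ c ∈ π.height.support, g (content c) (π.height c - 1) =
      ∑ n ∈ Finset.range N, ∑ h ∈ π.diagSet (-n), g (-n) h +
        ∑ n ∈ Finset.range N, ∑ h ∈ π.diagSet (n + 1 : ℕ), g (n + 1 : ℕ) h := by
  classical
  have hsum (k : ℤ) : ∑ h ∈ π.diagSet k, g k h =
      ∑ c ∈ π.height.support with content c = k, g (content c) (π.height c - 1) := by
    rw [diagSet, Finset.sum_image]
    · refine Finset.sum_congr rfl fun c hc => ?_
      rw [(Finset.mem_filter.1 hc).2]
    · intro c hc d hd hcd
      simp only [Finset.coe_filter, Finsupp.mem_support_iff, Set.mem_ofPred_eq] at hc hd hcd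
      exact hπ c d (hc.2.trans hd.2.symm) (by omega) (by omega)
  simp only [hsum]
  rw [← Finset.sum_fiberwise_of_maps_to (g := content)
    (t := (Finset.range N).image (fun n : ℕ => -(n : ℤ)) ∪
      (Finset.range N).image (fun n : ℕ => ((n + 1 : ℕ) : ℤ))), Finset.sum_union,
    Finset.sum_image, Finset.sum_image]
  · intro m _ n _ h
    simp only at h
    omega
  · intro m _ n _ h
    simp only at h
    omega
  · rw [Finset.disjoint_left]
    intro k h₁ h₂
    simp only [Finset.mem_image] at h₁ h₂
    obtain ⟨m, -, hm⟩ := h₁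
    obtain ⟨n, -, hn⟩ := h₂
    omega
  · intro c hc
    have h : |content c| < N := by
      by_contra h
      exact Finsupp.mem_support_iff.1 hc (hN c (by omega))
    rw [abs_lt] at h
    simp only [Finset.mem_union, Finset.mem_image, Finset.mem_range]
    rcases le_or_gt (content c) 0 with h' | h'
    · exact .inl ⟨(-content c).toNat, by omega, by omega⟩
    · exact .inr ⟨(content c - 1).toNat, by omega, by omega⟩

lemma DiagonallyStrict.volume_eq {π : PlanePartition} (hπ : π.DiagonallyStrict) {N : ℕ}
    (hN : π.DiagBounded N) :
    π.volume = ∑ n ∈ Finset.range N, size (π.diagSet (-n)) +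
      ∑ n ∈ Finset.range N, size (π.diagSet (n + 1 : ℕ)) := by
  rw [volume, Finsupp.sum]
  refine Eq.trans (Finset.sum_congr rfl fun c hc => ?_)
    (hπ.sum_support_eq hN fun _ h => h + 1)
  have := Finsupp.mem_support_iff.1 hc
  omega

lemma DiagonallyStrict.numPaths_eq {π : PlanePartition} (hπ : π.DiagonallyStrict) {N : ℕ}
    (hN : π.DiagBounded N) :
    π.numPaths =
      ∑ n ∈ Finset.range N, (π.diagSet (-n) \ π.diagSet (-(n + 1 : ℕ))).card +
        ∑ n ∈ Finset.range N, (π.diagSet (n + 1 : ℕ) \ π.diagSet n).card := by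
  have hcard (s t : Finset ℕ) : (s \ t).card = ∑ h ∈ s, if h ∉ t then 1 else 0 := by
    rw [Finset.sdiff_eq_filter, Finset.card_filter]
  rw [hπ.numPaths_eq_card, firstCells, Finset.card_filter,
    hπ.sum_support_eq hN fun k h => if h ∉ π.diagSet (k - 1) then 1 else 0]
  simp only [hcard]
  congr! 7 with n _ h _ n _ h _
  · push_cast
    ring
  · push_cast
    ring

end PlanePartition

namespace PlanePartition

open StrictPartition

/-! ### The generating function in terms of chains -/

/-- Abel summation, turning size differences of successive slices into the volume; the boundary term
vanishes when slice `N` is empty. -/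
lemma sum_range_succ_mul_sub {a : ℕ → ℕ} (ha : ∀ n, a (n + 1) ≤ a n) (N : ℕ) :
    ∑ n ∈ Finset.range N, (n + 1) * (a n - a (n + 1)) + N * a N = ∑ n ∈ Finset.range N, a n := by
  induction N with
  | zero => simp
  | succ N ih =>
    rw [Finset.sum_range_succ, Finset.sum_range_succ, ← ih]
    obtain ⟨b, hb⟩ := Nat.exists_eq_add_of_le (ha N)
    rw [hb, Nat.add_sub_cancel_left]
    ring

lemma sum_range_mul_sub {a : ℕ → ℕ} (ha : ∀ n, a (n + 1) ≤ a n) (N : ℕ) :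
    ∑ n ∈ Finset.range N, n * (a n - a (n + 1)) + N * a N =
      ∑ n ∈ Finset.range N, a (n + 1) := by
  induction N with
  | zero => simp
  | succ N ih =>
    rw [Finset.sum_range_succ, Finset.sum_range_succ, ← ih]
    obtain ⟨b, hb⟩ := Nat.exists_eq_add_of_le (ha N)
    rw [hb, Nat.add_sub_cancel_left]
    ring

lemma DiagonallyStrict.prod_upWeight {π : PlanePartition} (hπ : π.DiagonallyStrict) {N : ℕ}
    (hN : π.DiagBounded N) :
    ∏ n ∈ Finset.range N,
        upWeight (X ^ (n + 1)) (π.diagSet (-(n + 1 : ℕ))) (π.diagSet (-n)) =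
      2 ^ (∑ n ∈ Finset.range N, (π.diagSet (-n) \ π.diagSet (-(n + 1 : ℕ))).card) *
        X ^ (∑ n ∈ Finset.range N, size (π.diagSet (-n))) := by
  have h₀ : size (π.diagSet (-N)) = 0 := by
    rw [hN.diagSet_eq_empty (by simp), size_empty]
  have := sum_range_succ_mul_sub (a := fun n => size (π.diagSet (-n)))
    (fun n => size_le_of_interlace (hπ.interlace_diagSet_neg n)) N
  rw [h₀, mul_zero, add_zero] at this
  rw [← this, ← Finset.prod_pow_eq_pow_sum, ← Finset.prod_pow_eq_pow_sum,
    ← Finset.prod_mul_distrib]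
  refine Finset.prod_congr rfl fun n _ => ?_
  rw [upWeight, if_pos (hπ.interlace_diagSet_neg n), ← pow_mul]

lemma DiagonallyStrict.prod_downWeight {π : PlanePartition} (hπ : π.DiagonallyStrict) {N : ℕ}
    (hN : π.DiagBounded N) :
    ∏ n ∈ Finset.range N, downWeight (X ^ n) (π.diagSet n) (π.diagSet (n + 1 : ℕ)) =
      2 ^ (∑ n ∈ Finset.range N, (π.diagSet (n + 1 : ℕ) \ π.diagSet n).card) *
        X ^ (∑ n ∈ Finset.range N, size (π.diagSet (n + 1 : ℕ))) := by
  have h₀ : size (π.diagSet N) = 0 := by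
    rw [hN.diagSet_eq_empty (by simp), size_empty]
  have := sum_range_mul_sub (a := fun n => size (π.diagSet n))
    (fun n => size_le_of_interlace (hπ.interlace_diagSet_nat n)) N
  rw [h₀, mul_zero, add_zero] at this
  rw [← this, ← Finset.prod_pow_eq_pow_sum, ← Finset.prod_pow_eq_pow_sum,
    ← Finset.prod_mul_distrib]
  refine Finset.prod_congr rfl fun n _ => ?_
  rw [downWeight, if_pos (hπ.interlace_diagSet_nat n), ← pow_mul]

/-- The two chains of diagonal slices that start at the main diagonal. -/
def diagChains {N : ℕ} (π : {π : PlanePartition // π.DiagonallyStrict ∧ π.DiagBounded N}) :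
    Chain N × Chain N :=
  (⟨fun n => π.1.diagSet (-n), fun n hn => π.2.2.diagSet_eq_empty (by simpa using hn)⟩,
    ⟨fun n => π.1.diagSet n, fun n hn => π.2.2.diagSet_eq_empty (by simpa using hn)⟩)

lemma diagChains_injective (N : ℕ) : Function.Injective (diagChains (N := N)) := by
  rintro ⟨π, hπ⟩ ⟨ρ, hρ⟩ h
  simp only [diagChains, Prod.mk.injEq, Subtype.mk.injEq] at h
  refine Subtype.ext (hπ.1.ext_diagSet hρ.1 fun k => ?_)
  obtain ⟨n, rfl | rfl⟩ := k.eq_nat_or_neg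
  · exact congrFun h.2 n
  · exact congrFun h.1 n

lemma mem_range_diagChains {N : ℕ} {C D : Chain N} (h₀ : C.1 0 = D.1 0)
    (hC : ∀ n < N, Interlace (C.1 (n + 1)) (C.1 n))
    (hD : ∀ n < N, Interlace (D.1 (n + 1)) (D.1 n)) : (C, D) ∈ Set.range (diagChains (N := N)) := by
  have hall (E : Chain N) (hE : ∀ n < N, Interlace (E.1 (n + 1)) (E.1 n)) (n : ℕ) :
      Interlace (E.1 (n + 1)) (E.1 n) := by
    rcases lt_or_ge n N with hn | hn
    · exact hE n hn
    · rw [E.2 n hn, E.2 (n + 1) (by omega), interlace_empty_right]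
  let F : ℤ → Finset ℕ := fun k => if 0 ≤ k then D.1 k.toNat else C.1 (-k).toNat
  have hFpos (n : ℕ) : F n = D.1 n := by simp [F]
  have hFneg (n : ℕ) : F (-n) = C.1 n := by
    rcases Nat.eq_zero_or_pos n with rfl | hn
    · simp [F, h₀]
    · simp only [F]
      rw [if_neg (by omega)]
      simp
  obtain ⟨π, h₁, h₂, h₃⟩ := exists_diagSet_eq (N := N) F
    (fun k hk => by
      obtain ⟨n, rfl | rfl⟩ := k.eq_nat_or_neg
      · rw [hFpos, D.2 n (by simpa using hk)]
      · rw [hFneg, C.2 n (by simpa using hk)])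
    (fun n => by rw [hFpos, hFpos]; exact hall D hD n)
    (fun n => by rw [hFneg, hFneg]; exact hall C hC n)
  refine ⟨⟨π, h₁, h₂⟩, ?_⟩
  simp only [diagChains, h₃, hFpos, hFneg]

/-- The generating function of diagonally strict plane partitions with boundedly many diagonals. -/
lemma formalSum_diagBounded (N : ℕ) :
    formalSum (fun π : {π : PlanePartition // π.DiagonallyStrict ∧ π.DiagBounded N} =>
        2 ^ π.1.numPaths * X ^ π.1.volume) =
      ∏ j ∈ Finset.range N, ∏ i ∈ Finset.range N, cauchyFactor (X ^ (i + j + 1)) := by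
  have hX (i j : ℕ) : (X : ℝ≥0∞⟦X⟧) ^ (i + j + 1) = X ^ (i + 1) * X ^ j := by ring
  simp only [hX]
  rw [← formalSum_chain_pair N N (fun i => X ^ (i + 1)) fun j => X ^ j,
    ← formalSum_injective (diagChains_injective N)]
  · congr 1
    funext π
    rw [if_pos (by simp [diagChains])]
    simp only [diagChains]
    rw [π.2.1.prod_upWeight π.2.2, π.2.1.prod_downWeight π.2.2, π.2.1.numPaths_eq π.2.2,
      π.2.1.volume_eq π.2.2]
    ring
  · rintro ⟨C, D⟩ h
    rw [ite_ne_right_iff] at h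
    obtain ⟨h₀, h⟩ := h
    have h₁ := left_ne_zero_of_mul h
    have h₂ := right_ne_zero_of_mul h
    refine mem_range_diagChains h₀ (fun n hn => ?_) fun n hn => ?_
    · by_contra hcon
      refine h₁ (Finset.prod_eq_zero (Finset.mem_range.2 hn) ?_)
      rw [upWeight, if_neg hcon]
    · by_contra hcon
      refine h₂ (Finset.prod_eq_zero (Finset.mem_range.2 hn) ?_)
      rw [downWeight, if_neg hcon]

/-- All positions from the border to `(i, j)` along its row or column have positive height. Hence
the volume bounds the number of nonempty diagonals. -/
lemma lt_volume_of_height_pos {π : PlanePartition} {i j : ℕ} (h : 0 < π.height (i, j)) :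
    i < π.volume ∧ j < π.volume := by
  have hcard (s : Finset (ℕ × ℕ)) (hs : ∀ c ∈ s, c ≤ (i, j)) : s.card ≤ π.volume := by
    have hsub : s ⊆ π.height.support := fun c hc => by
      have := π.antitone_height (hs c hc)
      rw [Finsupp.mem_support_iff]
      omega
    rw [volume, Finsupp.sum]
    refine (Finset.card_le_card hsub).trans ?_
    rw [Finset.card_eq_sum_ones]
    exact Finset.sum_le_sum fun c hc => Nat.one_le_iff_ne_zero.2 (Finsupp.mem_support_iff.1 hc)
  constructor
  · have := hcard ((Finset.range (i + 1)).map ⟨fun n => (n, j), fun m n h => by simpa using h⟩)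
      (by simp only [Finset.forall_mem_map, Finset.mem_range, Nat.lt_succ_iff]
          exact fun a ha => Prod.mk_le_mk.2 ⟨ha, le_rfl⟩)
    simpa using this
  · have := hcard ((Finset.range (j + 1)).map ⟨fun n => (i, n), fun m n h => by simpa using h⟩)
      (by simp only [Finset.forall_mem_map, Finset.mem_range, Nat.lt_succ_iff]
          exact fun a ha => Prod.mk_le_mk.2 ⟨le_rfl, ha⟩)
    simpa using this

lemma diagBounded_of_volume_le {π : PlanePartition} {N : ℕ} (h : π.volume ≤ N) :
    π.DiagBounded N := by
  rintro ⟨i, j⟩ hc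
  by_contra h₀
  have := lt_volume_of_height_pos (Nat.pos_of_ne_zero h₀)
  rw [le_abs, content] at hc
  simp only at hc
  omega

end PlanePartition

/-! ### The product side -/

/-- The series `(1 + X ^ k) / (1 - X ^ k)`, with natural number coefficients. -/
def factorSeries (k : ℕ) : ℕ⟦X⟧ :=
  PowerSeries.mk fun n => if n = 0 then 1 else if k ∣ n then 2 else 0

lemma coeff_factorSeries (k n : ℕ) :
    coeff n (factorSeries k) = if n = 0 then 1 else if k ∣ n then 2 else 0 := by
  simp [factorSeries]

lemma map_factorSeries_eq_cauchyFactor {k : ℕ} (hk : 0 < k) :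
    PowerSeries.map (Nat.castRingHom ℝ≥0∞) (factorSeries k) = cauchyFactor (X ^ k) := by
  have h2 : (2 : ℝ≥0∞⟦X⟧) = C 2 := (map_ofNat C 2).symm
  ext n
  rw [cauchyFactor, geom, ← formalSum_mul_left, map_add, coeff_formalSum, coeff_map,
    coeff_factorSeries, coeff_one]
  simp only [mul_assoc, ← pow_mul, ← pow_add, h2, coeff_C_mul, coeff_X_pow]
  by_cases hn : n = 0
  · subst hn
    have (i : ℕ) : ¬ 0 = k + k * i := by omega
    simp [this]
  by_cases hd : k ∣ n
  · obtain ⟨m, rfl⟩ := hd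
    obtain ⟨m, rfl⟩ := Nat.exists_eq_succ_of_ne_zero (show m ≠ 0 by rintro rfl; simp at hn)
    rw [tsum_eq_single m]
    · rw [if_neg hn, if_neg hn, if_pos (dvd_mul_right k _), if_pos (by rw [Nat.succ_eq_add_one]; ring)]
      simp
    · intro i hi
      rw [if_neg, mul_zero]
      intro h
      apply hi
      have : k * (m + 1) = k * (i + 1) := by rw [h]; ring
      have := Nat.eq_of_mul_eq_mul_left hk this
      omega
  · have (i : ℕ) : ¬ n = k + k * i := by
      rintro rfl
      exact hd ⟨i + 1, by ring⟩
    simp [hn, hd, this]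

lemma map_factorSeries_mul {k : ℕ} (hk : 0 < k) :
    PowerSeries.map (Nat.castRingHom ℚ) (factorSeries k) * (1 - X ^ k) = 1 + X ^ k := by
  ext n
  rw [mul_sub, mul_one, map_sub, map_add, coeff_mul_X_pow', coeff_map, coeff_map,
    coeff_factorSeries, coeff_factorSeries, coeff_one, coeff_X_pow]
  rcases lt_trichotomy n k with h | rfl | h
  · rw [if_neg (show ¬ k ≤ n by omega), if_neg h.ne]
    by_cases hn : n = 0
    · simp [hn]
    · have : ¬ k ∣ n := fun hd => by
        have := Nat.le_of_dvd (by omega) hd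
        omega
      simp [hn, this]
  · have : n ≠ 0 := by omega
    simp [this]
    norm_num
  · have h₁ : n ≠ 0 := by omega
    have h₂ : n - k ≠ 0 := by omega
    have h₃ : k ∣ n - k ↔ k ∣ n := Nat.dvd_sub_iff_left h.le dvd_rfl
    simp [h₁, h₂, h₃, h.le, h.ne']

lemma map_factorSeries_eq {k : ℕ} (hk : 0 < k) :
    (1 + X ^ k) * (1 - X ^ k)⁻¹ = PowerSeries.map (Nat.castRingHom ℚ) (factorSeries k) := by
  rw [eq_comm, PowerSeries.eq_mul_inv_iff_mul_eq, map_factorSeries_mul hk]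
  simp [hk.ne']

lemma X_pow_dvd_factorSeries_sub_one (k : ℕ) :
    X ^ k ∣ PowerSeries.map (Nat.castRingHom ℚ) (factorSeries k) - 1 := by
  rw [X_pow_dvd_iff]
  intro m hm
  rw [map_sub, coeff_map, coeff_factorSeries, coeff_one]
  by_cases h : m = 0
  · simp [h]
  · have : ¬ k ∣ m := fun hd => by
      have := Nat.le_of_dvd (by omega) hd
      omega
    simp [h, this]

lemma coeff_eq_of_quotient_eq {N n : ℕ} (hn : n < N) {f g : ℚ⟦X⟧}
    (h : Ideal.Quotient.mk (Ideal.span {(X : ℚ⟦X⟧) ^ N}) f =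
      Ideal.Quotient.mk (Ideal.span {(X : ℚ⟦X⟧) ^ N}) g) : coeff n f = coeff n g := by
  rw [Ideal.Quotient.mk_eq_mk_iff_sub_mem, Ideal.mem_span_singleton, X_pow_dvd_iff] at h
  simpa [sub_eq_zero] using h n hn

lemma quotient_factorSeries {N k : ℕ} (h : N ≤ k) :
    Ideal.Quotient.mk (Ideal.span {(X : ℚ⟦X⟧) ^ N})
      (PowerSeries.map (Nat.castRingHom ℚ) (factorSeries k)) = 1 := by
  rw [← map_one (Ideal.Quotient.mk _), Ideal.Quotient.mk_eq_mk_iff_sub_mem,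
    Ideal.mem_span_singleton]
  exact (pow_dvd_pow X h).trans (X_pow_dvd_factorSeries_sub_one k)

/-- For `k < N` all `k + 1` pairs with sum `k` lie in the box; larger sums contribute 1. -/
lemma prod_box_eq {M : Type*} [CommMonoid M] {N : ℕ} (f : ℕ → M) (hf : ∀ k, N ≤ k → f k = 1) :
    ∏ j ∈ Finset.range N, ∏ i ∈ Finset.range N, f (i + j) =
      ∏ k ∈ Finset.range N, f k ^ (k + 1) := by
  rw [← Finset.prod_product', ← Finset.prod_fiberwise_of_maps_to (g := fun p => p.1 + p.2)
    (t := Finset.range (2 * N))]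
  · have hsub : Finset.range N ⊆ Finset.range (2 * N) := by
      intro k
      simp only [Finset.mem_range]
      omega
    refine Eq.trans ?_ (Finset.prod_subset hsub fun k _ hk => ?_).symm
    · refine Finset.prod_congr rfl fun k _ => ?_
      rw [Finset.prod_congr rfl (g := fun _ => f k) fun p hp => by
        rw [← (Finset.mem_filter.1 hp).2, add_comm], Finset.prod_const]
      rcases lt_or_ge k N with hk | hk
      · congr 1
        rw [← Finset.Nat.card_antidiagonal k]
        congr 1
        ext p
        simp only [Finset.mem_filter, Finset.mem_product, Finset.mem_range,
          Finset.HasAntidiagonal.mem_antidiagonal]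
        omega
      · simp [hf k hk]
    · rw [hf k (by simpa using hk), one_pow]
  · intro p hp
    simp only [Finset.mem_product, Finset.mem_range] at *
    omega

lemma multipliable_factorSeries : Multipliable fun n : ℕ =>
    PowerSeries.map (Nat.castRingHom ℚ) (factorSeries (n + 1)) ^ (n + 1) := by
  have h (n : ℕ) : PowerSeries.map (Nat.castRingHom ℚ) (factorSeries (n + 1)) ^ (n + 1) =
      1 + (PowerSeries.map (Nat.castRingHom ℚ) (factorSeries (n + 1)) ^ (n + 1) - 1) := by ring
  rw [funext h]
  apply WithPiTopology.multipliable_one_add_of_tendsto_order_atTop_nhds_top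
  refine ENat.tendsto_nhds_top_iff_natCast_lt.mpr fun n => Filter.eventually_atTop.mpr ⟨n, ?_⟩
  intro m hm
  have hdvd := (X_pow_dvd_factorSeries_sub_one (m + 1)).trans
    (sub_one_dvd_pow_sub_one _ (m + 1))
  refine lt_of_lt_of_le ?_ (nat_le_order _ _ (X_pow_dvd_iff.1 hdvd))
  exact_mod_cast Nat.lt_succ_of_le hm

/-- Modulo `X ^ N` the factors with `N ≤ k` are 1, so the partial products are constant from `N` on
and agree with the box product. -/
lemma coeff_tprod_factorSeries {N n : ℕ} (hn : n < N) :
    coeff n (∏' k : ℕ, PowerSeries.map (Nat.castRingHom ℚ) (factorSeries (k + 1)) ^ (k + 1)) =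
      ((coeff n (∏ j ∈ Finset.range N, ∏ i ∈ Finset.range N, factorSeries (i + j + 1)) : ℕ) :
        ℚ) := by
  have hlim := multipliable_factorSeries.hasProd.tendsto_prod_nat
  rw [WithPiTopology.tendsto_iff_coeff_tendsto] at hlim
  refine tendsto_nhds_unique (hlim n) (tendsto_atTop_of_eventually_const (i₀ := N) fun m hm => ?_)
  rw [← Nat.coe_castRingHom, ← coeff_map]
  apply coeff_eq_of_quotient_eq hn
  simp only [map_prod, map_pow]
  rw [prod_box_eq (fun k => Ideal.Quotient.mk (Ideal.span {(X : ℚ⟦X⟧) ^ N})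
    (PowerSeries.map (Nat.castRingHom ℚ) (factorSeries (k + 1))))
    fun k hk => quotient_factorSeries (by omega)]
  symm
  refine Finset.prod_subset (Finset.range_subset_range.2 hm) fun k _ hk => ?_
  rw [quotient_factorSeries, one_pow]
  simp only [Finset.mem_range] at hk
  omega

/-! ### The generating function of diagonally strict plane partitions -/

/-- A finite sum in ℝ≥0∞ has only finitely many terms that are at least 1, so the family has finite
support and the identity already holds in ℕ. -/
lemma hasSum_natCast_of_tsum_eq {ι : Type*} {f : ι → ℕ} {c : ℕ}
    (h : ∑' i, (f i : ℝ≥0∞) = c) : HasSum (fun i => (f i : ℚ)) c := by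
  classical
  have hfin : {i | (1 : ℝ≥0∞) ≤ f i}.Finite :=
    ENNReal.finite_const_le_of_tsum_ne_top (by rw [h]; simp) one_ne_zero
  have hzero : ∀ i ∉ hfin.toFinset, f i = 0 := by
    intro i hi
    by_contra h₀
    exact hi (by simpa using Nat.one_le_iff_ne_zero.2 h₀)
  rw [tsum_eq_sum fun i hi => by rw [hzero i hi, Nat.cast_zero]] at h
  have hc : ∑ i ∈ hfin.toFinset, f i = c := by exact_mod_cast h
  rw [← hc, Nat.cast_sum]
  exact hasSum_sum_of_ne_finset_zero fun i hi => by rw [hzero i hi, Nat.cast_zero]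

namespace PlanePartition

lemma coeff_two_pow_mul_X_pow {R : Type*} [CommSemiring R] (p v n : ℕ) :
    coeff n ((2 : R⟦X⟧) ^ p * X ^ v) = ((if n = v then 2 ^ p else 0 : ℕ) : R) := by
  have : (2 : R⟦X⟧) ^ p = C (2 ^ p) := by rw [map_pow, map_ofNat]
  rw [this, coeff_C_mul, coeff_X_pow]
  split_ifs <;> simp

lemma tsum_coeff_eq (n : ℕ) :
    ∑' π : {π : PlanePartition // π.DiagonallyStrict},
        ((if n = π.1.volume then 2 ^ π.1.numPaths else 0 : ℕ) : ℝ≥0∞) =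
      (coeff n (∏ j ∈ Finset.range (n + 1), ∏ i ∈ Finset.range (n + 1),
        factorSeries (i + j + 1)) : ℕ) := by
  -- Plane partitions of volume `n` satisfy `DiagBounded (n + 1)`, so the truncation does not affect
  -- this coefficient.
  have h := congrArg (coeff n) (formalSum_diagBounded (n + 1))
  simp only [coeff_formalSum, coeff_two_pow_mul_X_pow] at h
  rw [← Nat.coe_castRingHom (α := ℝ≥0∞), ← coeff_map]
  simp only [map_prod, map_factorSeries_eq_cauchyFactor (Nat.succ_pos _)]
  rw [← h]
  let g : {π : PlanePartition // π.DiagonallyStrict ∧ π.DiagBounded (n + 1)} →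
    {π : PlanePartition // π.DiagonallyStrict} := fun π => ⟨π.1, π.2.1⟩
  have hg : Function.Injective g := fun π ρ h => Subtype.ext (congrArg (fun x => x.1) h)
  refine (hg.tsum_eq fun π hπ => ?_).symm
  have hv : n = π.1.volume := by
    by_contra hv
    exact hπ (by simp [hv])
  exact ⟨⟨π.1, π.2, diagBounded_of_volume_le (by omega)⟩, rfl⟩

lemma hasSum_two_pow_numPaths :
    HasSum (fun π : {π : PlanePartition // π.DiagonallyStrict} =>
      (2 : ℚ⟦X⟧) ^ π.1.numPaths * X ^ π.1.volume)
      (∏' n : ℕ, PowerSeries.map (Nat.castRingHom ℚ) (factorSeries (n + 1)) ^ (n + 1)) := by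
  rw [WithPiTopology.hasSum_iff_hasSum_coeff]
  intro n
  simp only [coeff_two_pow_mul_X_pow]
  rw [coeff_tprod_factorSeries (Nat.lt_succ_self n)]
  exact hasSum_natCast_of_tsum_eq (tsum_coeff_eq n)

end PlanePartition

theorem mainTheorem1 :
    (∀ π : PlanePartition, π.DiagonallyStrict ↔ π.OneColumnWide) ∧
    Summable (fun π : {π : PlanePartition // π.DiagonallyStrict} =>
      (2 : ℚ⟦X⟧) ^ π.1.numPaths * PowerSeries.X ^ π.1.volume) ∧
    Multipliable (fun n : ℕ =>
      ((1 + PowerSeries.X ^ (n + 1)) * (1 - PowerSeries.X ^ (n + 1))⁻¹ : ℚ⟦X⟧) ^ (n + 1)) ∧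
    ∑' π : {π : PlanePartition // π.DiagonallyStrict},
        (2 : ℚ⟦X⟧) ^ π.1.numPaths * PowerSeries.X ^ π.1.volume =
      ∏' n : ℕ,
        ((1 + PowerSeries.X ^ (n + 1)) * (1 - PowerSeries.X ^ (n + 1))⁻¹ : ℚ⟦X⟧) ^ (n + 1) := by
  simp only [map_factorSeries_eq (Nat.succ_pos _)]
  exact ⟨PlanePartition.diagonallyStrict_iff_oneColumnWide,
    PlanePartition.hasSum_two_pow_numPaths.summable, multipliable_factorSeries,
    PlanePartition.hasSum_two_pow_numPaths.tsum_eq⟩
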